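/- Let $m,n$ be positive integers. Let $\mathcal{P}(n)$ be the set of permutations of $\{0,1\}^n$, and let $\mathcal{E}(m,n)$ be the set of block ciphers, i.e. families $E=(E_k)_{k\in\{0,1\}^m}$ with $E_k\in\mathcal{P}(n)$. For $E\in\mathcal{E}(m,n)$ and $K=(k_0,k_1,k_2)\in\{0,1\}^m\times\{0,1\}^n\times\{0,1\}^n$ put $\mathsf{FX}_K[E](x)=E_{k_0}(x\oplus k_1)\oplus k_2$, a permutation of $\{0,1\}^n$. Let $\mathcal{A}$ be a computationally unbounded adaptive quantum algorithm (on finite-dimensional registers) with two oracles: classical two-way access to a permutation $P$ of $\{0,1\}^n$ (it may query $P$ or $P^{-1}$ on classical inputs), written $\pm P$, and quantum two-way access to a block cipher $E$ (it may apply $|k\rangle|x\rangle|y\rangle\mapsto|k\rangle|x\rangle|y\oplus E_k(x)\rangle$ and $|k\rangle|x\rangle|y\rangle\mapsto|k\rangle|x\rangle|y\oplus E_k^{-1}(x)\rangle$ to its registers), written $|\pm E\rangle$; which query comes next, and in which direction, may depend on all earlier answers and measurement outcomes. Suppose that $\mathcal{A}$ makes at most $q_C\le 2^n$ classical queries and at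 most $q_Q$ quantum queries. Then, all samples being uniform and independent, $$\left|\Pr_{\substack{K\leftarrow\{0,1\}^{m+2n}\\ E\leftarrow\mathcal{E}(m,n)}}\left[\mathcal{A}^{\pm\mathsf{FX}_K[E],\,|\pm E\rangle}=1\right]-\Pr_{\substack{R\leftarrow\mathcal{P}(n)\\ E\leftarrow\mathcal{E}(m,n)}}\left[\mathcal{A}^{\pm R,\,|\pm E\rangle}=1\right]\right|\le\frac{4}{\sqrt{2^m(2^n-q_C+1)}}\,q_C\sqrt{q_Q}+\frac{2}{\sqrt{2^{m+n}}}\,q_Q\sqrt{q_C}.$$ -/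

import Mathlib

/-- Bit strings of length `n`; addition is the bitwise XOR. -/
abbrev Bits (n : ℕ) : Type := Fin n → ZMod 2

/-- Block ciphers with key length `m` and block length `n`: for every key a permutation of the
blocks. A uniformly random element of this finite type is an ideal cipher. -/
abbrev BlockCipher (m n : ℕ) : Type := Bits m → Equiv.Perm (Bits n)

/-- The permutation `x ↦ E_{k₀}(x ⊕ k₁) ⊕ k₂`. -/
def fxCipher {m n : ℕ} (E : BlockCipher m n) (k₀ : Bits m) (k₁ k₂ : Bits n) :
    Equiv.Perm (Bits n) where
  toFun x := E k₀ (x + k₁) + k₂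
  invFun y := (E k₀).symm (y - k₂) - k₁
  left_inv x := by simp
  right_inv y := by simp

/-- Labels of the computational basis of the adversary's registers: a work register with label
set `W`, a key register, a block register (query input), a block register (query output). -/
abbrev BasisLabel (m n : ℕ) (W : Type*) : Type _ := W × Bits m × Bits n × Bits n

/-- The Hilbert space of the adversary's registers. -/
abbrev QState (m n : ℕ) (W : Type*) : Type _ := EuclideanSpace ℂ (BasisLabel m n W)

/-- The map `(w, k, x, y) ↦ (w, k, x, y ⊕ f k x)` on basis labels. -/
def queryPerm {m n : ℕ} (W : Type*) (f : Bits m → Bits n → Bits n) :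
    Equiv.Perm (BasisLabel m n W) where
  toFun v := (v.1, v.2.1, v.2.2.1, v.2.2.2 + f v.2.1 v.2.2.1)
  invFun v := (v.1, v.2.1, v.2.2.1, v.2.2.2 - f v.2.1 v.2.2.1)
  left_inv v := by simp
  right_inv v := by simp

/-- The quantum oracle of a keyed function `f`, that is, the unitary
`|w⟩|k⟩|x⟩|y⟩ ↦ |w⟩|k⟩|x⟩|y ⊕ f k x⟩`. -/
noncomputable def quantumOracle {m n : ℕ} {W : Type*} [Fintype W]
    (f : Bits m → Bits n → Bits n) : QState m n W ≃ₗᵢ[ℂ] QState m n W :=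
  LinearIsometryEquiv.piLpCongrLeft 2 ℂ ℂ (queryPerm W f)

/-- Adaptive quantum algorithms with classical two-way access to a permutation of the blocks and
quantum two-way access to a block cipher, as decision trees. Every decision (which oracle is called
next, in which direction, on which classical input, and when to stop) may depend on all
measurement outcomes and all classical answers obtained so far.

* `output b`: stop with output `b`.
* `measure M hM next`: apply the measurement with Kraus operators `M i`, and continue with
  `next i` on outcome `i`. (One outcome: a unitary. It also covers internal randomness.)
* `classicalFwd x next`: query the permutation `P` at `x`, continue with `next (P x)`.
* `classicalInv y next`: query `P⁻¹` at `y`, continue with `next (P⁻¹ y)`.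
* `quantumFwd next`: apply the quantum oracle of `(k, x) ↦ E_k(x)` to the query registers.
* `quantumInv next`: apply the quantum oracle of `(k, x) ↦ E_k⁻¹(x)` to the query registers. -/
inductive QAlgorithm (m n : ℕ) (W : Type*) [Fintype W]
  | output (b : Bool) : QAlgorithm m n W
  | measure {r : ℕ} (M : Fin r → (QState m n W →L[ℂ] QState m n W))
      (hM : ∑ i, star (M i) * M i = 1) (next : Fin r → QAlgorithm m n W) : QAlgorithm m n W
  | classicalFwd (x : Bits n) (next : Bits n → QAlgorithm m n W) : QAlgorithm m n W
  | classicalInv (y : Bits n) (next : Bits n → QAlgorithm m n W) : QAlgorithm m n W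
  | quantumFwd (next : QAlgorithm m n W) : QAlgorithm m n W
  | quantumInv (next : QAlgorithm m n W) : QAlgorithm m n W

namespace QAlgorithm

variable {m n : ℕ} {W : Type*} [Fintype W]

/-- The largest number of classical queries (in either direction) on a branch. -/
def classicalQueries : QAlgorithm m n W → ℕ
  | output _ => 0
  | measure _ _ next => Finset.univ.sup fun i => (next i).classicalQueries
  | classicalFwd _ next => (Finset.univ.sup fun z => (next z).classicalQueries) + 1
  | classicalInv _ next => (Finset.univ.sup fun z => (next z).classicalQueries) + 1
  | quantumFwd next => next.classicalQueries
  | quantumInv next => next.classicalQueries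

/-- The largest number of quantum queries (in either direction) on a branch. -/
def quantumQueries : QAlgorithm m n W → ℕ
  | output _ => 0
  | measure _ _ next => Finset.univ.sup fun i => (next i).quantumQueries
  | classicalFwd _ next => Finset.univ.sup fun z => (next z).quantumQueries
  | classicalInv _ next => Finset.univ.sup fun z => (next z).quantumQueries
  | quantumFwd next => next.quantumQueries + 1
  | quantumInv next => next.quantumQueries + 1

/-- The probability of output `1`, when classical queries are answered by `P` and quantum queries
by `E`, from the state `ψ`. States are not renormalized after a measurement: the squared norm of
the current state is the probability (times the squared norm of the initial state) of the
current branch. -/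
noncomputable def acceptProb (P : Equiv.Perm (Bits n)) (E : BlockCipher m n) :
    QAlgorithm m n W → QState m n W → ℝ
  | output b, ψ => if b then ‖ψ‖ ^ 2 else 0
  | measure M _ next, ψ => ∑ i, (next i).acceptProb P E (M i ψ)
  | classicalFwd x next, ψ => (next (P x)).acceptProb P E ψ
  | classicalInv y next, ψ => (next (P.symm y)).acceptProb P E ψ
  | quantumFwd next, ψ => next.acceptProb P E (quantumOracle (fun k x => E k x) ψ)
  | quantumInv next, ψ => next.acceptProb P E (quantumOracle (fun k x => (E k).symm x) ψ)

end QAlgorithm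

/-- An adversary: an adaptive quantum algorithm with an initial (normalized) state. -/
structure QAdversary (m n : ℕ) (W : Type*) [Fintype W] where
  /-- the initial state -/
  init : QState m n W
  norm_init : ‖init‖ = 1
  /-- the algorithm run on it -/
  alg : QAlgorithm m n W

/-- `Pr[A^{±FX_K[E], |±E⟩} = 1]` over uniform `E` and uniform `K = (k₀, k₁, k₂)`. -/
noncomputable def QAdversary.realProb {m n : ℕ} {W : Type*} [Fintype W]
    (A : QAdversary m n W) : ℝ :=
  Finset.expect Finset.univ fun s : BlockCipher m n × Bits m × Bits n × Bits n =>
    A.alg.acceptProb (fxCipher s.1 s.2.1 s.2.2.1 s.2.2.2) s.1 A.init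

/-- `Pr[A^{±R, |±E⟩} = 1]` over uniform `E` and an independent uniform permutation `R`. -/
noncomputable def QAdversary.idealProb {m n : ℕ} {W : Type*} [Fintype W]
    (A : QAdversary m n W) : ℝ :=
  Finset.expect Finset.univ fun s : BlockCipher m n × Equiv.Perm (Bits n) =>
    A.alg.acceptProb s.2 s.1 A.init

/-!
The construction with key `K = (k₀, k₁, k₂)` shares with the quantum oracle only the permutation
`E k₀`. Given the transcript `T` of the classical queries so far, the real world is as if a random
permutation had answered these queries and `E` had then been reprogrammed to agree with them: with
`E' = reprogramCipher T K E`, the permutation `E' k₀` takes `T.length` prescribed values, in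
places that are shifted by the random outer keys `k₁` and `k₂`. A fresh classical query answered by
a random fresh value keeps `(K, E')` distributed like a key and a block cipher consistent with `T`
(`expect_expect_reprogramCipher_cons`).

For a fixed transcript and fixed measurement outcomes, the unnormalized state of the adversary is a
function `ψ` of the block cipher. The ideal run is in the state `ψ E`, the real run in the state
`ψ E'`, so that everything rests on their mean square distance `deviation T ψ`.

* A fresh classical query prescribes one more value. On average over the answer this has the same
  effect as exchanging two values of `E k₀` beforehand (`expect_reprogram_cons`), so that the root
  mean square distance grows by at most the square root of `2 ^ n / M * spread ψ`, where `spread ψ`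
  measures the dependence of `ψ` on the block cipher and `M` bounds the number of free points from
  below (`expect_deviation_cons_le`). The spread grows by at most `4 / 2 ^ (m + n)` with every
  quantum query (`spread_queryFwd_le`).
* A quantum query applies the oracles of `E` and `E'` to the two states. Since translations of bit
  strings are involutions, the change of the squared distance is an inner product of the differences
  of each state with its translate by `E k x + E' k x` (`norm_quantumOracle_sub_sq`). This shift
  vanishes except with probability `2 * T.length / 2 ^ (m + n)`. It depends on the state `ψ E'`;
  but given `E'` the original values at the reprogrammed points are random, so that `ψ E'` may be
  compared with the ideal state for an independent block cipher with the same reprogramming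
  (`deviation_queryFwd_le`). Hence the root mean square distance grows by at most
  `β = √(4 c / 2 ^ (m + n))` if there are at most `c` classical queries.

Measurements split the run into branches, over which squared distances are additive and root mean
squares are not. The hybrid argument (`abs_discrepancy_le`) therefore follows the quotient of the
deviation by a number `D` that grows with every query as the root mean square distance would; the
parameters of the growth are free, and are optimized only at the end. Writing `g` and `h` for the
total growth by the classical and the quantum queries, `D` runs from `2 * g` to at most `3 * g + h`,
and `(3 * g + h) * (g + h) ≤ (2 * g + h) ^ 2` gives the advantage `2 * g + h`.

Inverse queries reduce to forward queries: replace the block cipher by its inverse, exchange the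
outer keys and reverse the pairs in the transcript.
-/

/-! ### Reprogramming permutations -/

section Reprogramming

open Finset Equiv
open scoped BigOperators

variable {α : Type*}

/-- The list is the graph of a partial injection, listed without repetition. -/
def IsPartialInj (U : List (α × α)) : Prop := U.Pairwise fun p q => p.1 ≠ q.1 ∧ p.2 ≠ q.2

lemma isPartialInj_nil : IsPartialInj ([] : List (α × α)) := List.Pairwise.nil

lemma isPartialInj_cons {p : α × α} {U : List (α × α)} :
    IsPartialInj (p :: U) ↔ (∀ q ∈ U, p.1 ≠ q.1 ∧ p.2 ≠ q.2) ∧ IsPartialInj U :=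
  List.pairwise_cons

lemma IsPartialInj.map_swap {U : List (α × α)} (hU : IsPartialInj U) :
    IsPartialInj (U.map Prod.swap) := by
  unfold IsPartialInj
  rw [List.pairwise_map]
  exact List.Pairwise.imp (fun h => ⟨h.2, h.1⟩) hU

variable [DecidableEq α]

/-- The permutation obtained from `F` by forcing the value `p.2` at `p.1`; the point that `F` maps
to `p.2` receives the old value of `p.1`. -/
def assign (p : α × α) (F : Perm α) : Perm α := swap (F p.1) p.2 * F

/-- The permutation `F` reprogrammed to satisfy all the constraints `p.1 ↦ p.2` in the list `U`. -/
def reprogram (U : List (α × α)) (F : Perm α) : Perm α := U.foldr assign F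

@[simp] lemma reprogram_nil (F : Perm α) : reprogram [] F = F := rfl

@[simp] lemma reprogram_cons (p : α × α) (U : List (α × α)) (F : Perm α) :
    reprogram (p :: U) F = assign p (reprogram U F) := rfl

lemma assign_apply_fst (p : α × α) (F : Perm α) : assign p F p.1 = p.2 := by
  simp [assign]

lemma assign_comm {p q : α × α} (h₁ : p.1 ≠ q.1) (h₂ : p.2 ≠ q.2) (F : Perm α) :
    assign p (assign q F) = assign q (assign p F) := by
  have h : F p.1 ≠ F q.1 := fun h => h₁ (F.injective h)
  ext z
  simp only [assign, Perm.mul_apply, swap_apply_def]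
  generalize F p.1 = a at *
  generalize F q.1 = b at *
  generalize F z = c at *
  grind

lemma assign_mul_of_fst {p : α × α} {σ : Perm α} (h : σ p.1 = p.1) (F : Perm α) :
    assign p (F * σ) = assign p F * σ := by
  simp [assign, h, mul_assoc]

lemma assign_inv (p : α × α) (F : Perm α) : (assign p F)⁻¹ = assign p.swap F⁻¹ := by
  simp only [assign, mul_inv_rev, swap_inv, Prod.fst_swap, Prod.snd_swap]
  rw [mul_swap_eq_swap_mul, swap_comm]
  simp

lemma assign_eq_mul_swap (F : Perm α) (u r : α) : assign (u, F r) F = F * swap u r := by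
  simp [assign, mul_swap_eq_swap_mul]

lemma reprogram_apply {U : List (α × α)} (hU : IsPartialInj U) (F : Perm α) {p : α × α}
    (hp : p ∈ U) : reprogram U F p.1 = p.2 := by
  induction U with
  | nil => simp at hp
  | cons q U ih =>
    obtain ⟨hq, hU⟩ := isPartialInj_cons.1 hU
    rcases List.mem_cons.1 hp with rfl | hp
    · exact assign_apply_fst _ _
    · have h := ih hU hp
      have h' : p.2 ≠ reprogram U F q.1 := by
        rw [← h]; exact fun e => (hq p hp).1 ((reprogram U F).injective e).symm
      simp only [reprogram_cons, assign, Perm.mul_apply, h]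
      exact swap_apply_of_ne_of_ne h' (hq p hp).2.symm

lemma reprogram_apply_of_notMem (U : List (α × α)) (F : Perm α) {x : α}
    (hx : ∀ p ∈ U, p.1 ≠ x) (hy : ∀ p ∈ U, p.2 ≠ F x) : reprogram U F x = F x := by
  induction U with
  | nil => rfl
  | cons q U ih =>
    have h := ih (fun p hp => hx p (List.mem_cons_of_mem _ hp))
      (fun p hp => hy p (List.mem_cons_of_mem _ hp))
    simp only [reprogram_cons, assign, Perm.mul_apply]
    rw [h]
    refine swap_apply_of_ne_of_ne ?_ (hy q List.mem_cons_self).symm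
    rw [← h]
    exact fun e => hx q List.mem_cons_self ((reprogram U F).injective e).symm

lemma reprogram_mul {U : List (α × α)} {σ : Perm α} (h : ∀ p ∈ U, σ p.1 = p.1) (F : Perm α) :
    reprogram U (F * σ) = reprogram U F * σ := by
  induction U with
  | nil => rfl
  | cons q U ih =>
    simp only [reprogram_cons]
    rw [ih fun p hp => h p (List.mem_cons_of_mem _ hp), assign_mul_of_fst (h q List.mem_cons_self)]

lemma reprogram_inv (U : List (α × α)) (F : Perm α) :
    (reprogram U F)⁻¹ = reprogram (U.map Prod.swap) F⁻¹ := by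
  induction U with
  | nil => rfl
  | cons q U ih => simp only [reprogram_cons, assign_inv, ih, List.map_cons]

lemma reprogram_assign {p : α × α} {U : List (α × α)} (h : ∀ q ∈ U, p.1 ≠ q.1 ∧ p.2 ≠ q.2)
    (F : Perm α) : reprogram U (assign p F) = assign p (reprogram U F) := by
  induction U with
  | nil => rfl
  | cons q U ih =>
    have hq := h q List.mem_cons_self
    simp only [reprogram_cons]
    rw [ih fun r hr => h r (List.mem_cons_of_mem _ hr), assign_comm hq.1.symm hq.2.symm]

/-- The order of the constraints does not matter: any one of them can be imposed before all the
others. -/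
lemma exists_reprogram_eq {U : List (α × α)} (hU : IsPartialInj U) {p : α × α} (hp : p ∈ U) :
    ∃ U' : List (α × α), ∀ F, reprogram U F = reprogram U' (assign p F) := by
  obtain ⟨s, t, rfl⟩ := List.append_of_mem hp
  refine ⟨s ++ t, fun F => ?_⟩
  have h := (List.pairwise_cons.1 (List.pairwise_append.1 hU).2.1).1
  simp only [reprogram, List.foldr_append, List.foldr_cons]
  exact congrArg (fun G => List.foldr assign G s) (reprogram_assign h F).symm

/-- The points not constrained by the list. -/
def freeInputs [Fintype α] (U : List (α × α)) : Finset α := {x | ∀ p ∈ U, p.1 ≠ x}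

/-- The values not taken by the partial injection of the list. -/
def freeOutputs [Fintype α] (U : List (α × α)) : Finset α := {y | ∀ p ∈ U, p.2 ≠ y}

variable [Fintype α]

lemma mem_freeInputs {U : List (α × α)} {x : α} : x ∈ freeInputs U ↔ ∀ p ∈ U, p.1 ≠ x := by
  simp [freeInputs]

lemma mem_freeOutputs {U : List (α × α)} {y : α} : y ∈ freeOutputs U ↔ ∀ p ∈ U, p.2 ≠ y := by
  simp [freeOutputs]

lemma freeInputs_map_swap (U : List (α × α)) : freeInputs (U.map Prod.swap) = freeOutputs U := by
  ext x; simp only [mem_freeInputs, mem_freeOutputs, List.forall_mem_map, Prod.fst_swap]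

lemma freeOutputs_map_swap (U : List (α × α)) : freeOutputs (U.map Prod.swap) = freeInputs U := by
  ext x; simp only [mem_freeInputs, mem_freeOutputs, List.forall_mem_map, Prod.snd_swap]

lemma card_le_card_freeInputs_add (U : List (α × α)) :
    Fintype.card α ≤ (freeInputs U).card + U.length := by
  have h : (univ : Finset α) ⊆ freeInputs U ∪ (U.map Prod.fst).toFinset := by
    intro x _
    by_cases hx : x ∈ freeInputs U
    · simp [hx]
    · simp only [mem_freeInputs, not_forall, not_not] at hx
      obtain ⟨p, hp, rfl⟩ := hx
      simp only [mem_union, List.mem_toFinset, List.mem_map]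
      exact Or.inr ⟨p, hp, rfl⟩
  calc Fintype.card α = (univ : Finset α).card := rfl
    _ ≤ _ := card_le_card h
    _ ≤ _ := card_union_le _ _
    _ ≤ _ := by
      gcongr
      simpa using List.toFinset_card_le (U.map Prod.fst)

lemma card_le_card_freeOutputs_add (U : List (α × α)) :
    Fintype.card α ≤ (freeOutputs U).card + U.length := by
  simpa [freeInputs_map_swap] using card_le_card_freeInputs_add (U.map Prod.swap)

lemma apply_mem_freeOutputs {U : List (α × α)} (hU : IsPartialInj U) (F : Perm α) {x : α}
    (hx : x ∈ freeInputs U) : reprogram U F x ∈ freeOutputs U := by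
  rw [mem_freeInputs] at hx
  rw [mem_freeOutputs]
  intro p hp e
  rw [← reprogram_apply hU F hp] at e
  exact hx p hp ((reprogram U F).injective e)

lemma inv_apply_mem_freeInputs {U : List (α × α)} (hU : IsPartialInj U) (F : Perm α) {y : α}
    (hy : y ∈ freeOutputs U) : (reprogram U F)⁻¹ y ∈ freeInputs U := by
  have h := apply_mem_freeOutputs hU.map_swap F⁻¹ (x := y) (by rwa [freeInputs_map_swap])
  rwa [← reprogram_inv, freeOutputs_map_swap] at h

/-- Assigning a random free value to the free point `u` amounts to swapping `u` with a random free
point beforehand. -/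
lemma expect_reprogram_cons {U : List (α × α)} (hU : IsPartialInj U) {u : α}
    (hu : u ∈ freeInputs U) (F : Perm α) (h : Perm α → ℝ) :
    𝔼 v ∈ freeOutputs U, h (reprogram ((u, v) :: U) F) =
      𝔼 r ∈ freeInputs U, h (reprogram U (F * swap u r)) := by
  refine Finset.expect_nbij' (fun v => (reprogram U F)⁻¹ v) (fun r => reprogram U F r)
    (fun v hv => inv_apply_mem_freeInputs hU F hv) (fun r hr => apply_mem_freeOutputs hU F hr)
    (fun v _ => by simp) (fun r _ => by simp) (fun v hv => ?_)
  have hr := inv_apply_mem_freeInputs hU F hv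
  rw [mem_freeInputs] at hu hr
  rw [reprogram_mul fun p hp => swap_apply_of_ne_of_ne (hu p hp) (hr p hp), ← assign_eq_mul_swap]
  simp

/-- The permutations with the same reprogramming as `F₀`. -/
def reprogramFiber (U : List (α × α)) (F₀ : Perm α) : Finset (Perm α) :=
  {F | reprogram U F = reprogram U F₀}

lemma mem_reprogramFiber {U : List (α × α)} {F₀ F : Perm α} :
    F ∈ reprogramFiber U F₀ ↔ reprogram U F = reprogram U F₀ := by
  simp [reprogramFiber]

/-- Given the reprogrammed permutation, the original value at a reprogrammed point is uniform. -/
lemma expect_reprogramFiber_apply {U : List (α × α)} (hU : IsPartialInj U) (F₀ : Perm α)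
    {p : α × α} (hp : p ∈ U) (g : α → ℝ) :
    𝔼 F ∈ reprogramFiber U F₀, g (F p.1) = 𝔼 v, g v := by
  obtain ⟨U', hU'⟩ := exists_reprogram_eq hU hp
  have hne : (reprogramFiber U F₀).Nonempty := ⟨F₀, mem_reprogramFiber.2 rfl⟩
  have hα : (univ : Finset α).Nonempty := ⟨p.1, mem_univ _⟩
  -- replacing the value at `p.1` by `w` does not leave the fibre, and is undone by putting back
  -- the old value
  have key : ∀ F : Perm α, ∀ w : α, assign p (swap w p.2 * assign p F) = assign p F := by
    intro F w
    have : (swap w p.2 * assign p F) p.1 = w := by simp [assign_apply_fst]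
    rw [assign, this, ← mul_assoc, swap_mul_self, one_mul]
  have hval : ∀ F : Perm α, ∀ w : α, (swap w p.2 * assign p F) p.1 = w := by
    intro F w; simp [assign_apply_fst]
  have hmem : ∀ F ∈ reprogramFiber U F₀, ∀ w, swap w p.2 * assign p F ∈ reprogramFiber U F₀ := by
    intro F hF w
    rw [mem_reprogramFiber] at hF ⊢
    rw [hU', key, ← hU', hF]
  have hback : ∀ F : Perm α, swap (F p.1) p.2 * assign p F = F := by
    intro F
    rw [assign, ← mul_assoc, swap_mul_self, one_mul]
  calc 𝔼 F ∈ reprogramFiber U F₀, g (F p.1)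
      = 𝔼 F ∈ reprogramFiber U F₀, 𝔼 _w : α, g (F p.1) := by simp [Finset.expect_const hα]
    _ = 𝔼 F ∈ reprogramFiber U F₀, 𝔼 w : α, g w := by
      rw [← Finset.expect_product' (reprogramFiber U F₀) univ fun F _ => g (F p.1),
        ← Finset.expect_product' (reprogramFiber U F₀) univ fun _ w => g w]
      refine Finset.expect_nbij' (fun s => (swap s.2 p.2 * assign p s.1, s.1 p.1))
        (fun s => (swap s.2 p.2 * assign p s.1, s.1 p.1)) ?_ ?_ ?_ ?_ ?_
      · intro s hs
        simp only [mem_product, mem_univ, and_true] at hs ⊢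
        exact hmem _ hs _
      · intro s hs
        simp only [mem_product, mem_univ, and_true] at hs ⊢
        exact hmem _ hs _
      · intro s _
        ext1 <;> simp only [key, hval, hback]
      · intro s _
        ext1 <;> simp only [key, hval, hback]
      · intro s _
        rfl
    _ = 𝔼 v, g v := Finset.expect_const hne _

/-- Given the reprogrammed permutation `F'`, the original value at a point `x` that is not
constrained is either `F' x`, where `g` vanishes here, or one of the constrained values, each of the
latter with probability `1 / |α|`. -/
lemma expect_reprogramFiber_apply_of_mem_freeInputs {U : List (α × α)} (hU : IsPartialInj U)
    (F₀ : Perm α) {x : α} (hx : x ∈ freeInputs U) (g : α → ℝ) (hg₀ : g (reprogram U F₀ x) = 0) :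
    𝔼 F ∈ reprogramFiber U F₀, g (F x) =
      (Fintype.card α : ℝ)⁻¹ * ∑ v ∈ (freeOutputs U)ᶜ, g v := by
  have h1 : ∀ v ∈ (freeOutputs U)ᶜ,
      𝔼 F ∈ reprogramFiber U F₀, (if F x = v then (1 : ℝ) else 0) = (Fintype.card α : ℝ)⁻¹ := by
    intro v hv
    simp only [mem_compl, mem_freeOutputs, not_forall, not_not] at hv
    obtain ⟨p, hp, rfl⟩ := hv
    have h := expect_reprogramFiber_apply hU.map_swap F₀⁻¹ (p := p.swap)
      (List.mem_map_of_mem hp) (fun z => if z = x then (1 : ℝ) else 0)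
    have h2 : 𝔼 v : α, (if v = x then (1 : ℝ) else 0) = (Fintype.card α : ℝ)⁻¹ := by
      rw [Finset.expect_eq_sum_div_card]; simp
    rw [← h2, ← h]
    refine Finset.expect_nbij' (fun F => F⁻¹) (fun F => F⁻¹) ?_ ?_ (by simp) (by simp) ?_
    · intro F hF
      rw [mem_reprogramFiber] at hF ⊢
      rw [← reprogram_inv, ← reprogram_inv, hF]
    · intro F hF
      rw [mem_reprogramFiber] at hF ⊢
      have := congrArg (·⁻¹) hF
      simpa [reprogram_inv, Function.comp_def] using this
    · intro F _
      have : F x = p.2 ↔ F⁻¹ p.2 = x := by rw [Perm.inv_eq_iff_eq, eq_comm]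
      simp [this]
  calc 𝔼 F ∈ reprogramFiber U F₀, g (F x)
      = 𝔼 F ∈ reprogramFiber U F₀,
          ∑ v ∈ (freeOutputs U)ᶜ, (if F x = v then (1 : ℝ) else 0) * g v := by
        refine Finset.expect_congr rfl fun F hF => ?_
        simp only [ite_mul, one_mul, zero_mul, Finset.sum_ite_eq]
        split_ifs with hm
        · rfl
        · rw [mem_compl, not_not, mem_freeOutputs] at hm
          rw [mem_freeInputs] at hx
          rw [mem_reprogramFiber] at hF
          rw [← reprogram_apply_of_notMem U F hx hm, hF, hg₀]
    _ = ∑ v ∈ (freeOutputs U)ᶜ,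
          (𝔼 F ∈ reprogramFiber U F₀, (if F x = v then (1 : ℝ) else 0)) * g v := by
        rw [Finset.expect_sum_comm]
        simp only [Finset.expect_mul]
    _ = _ := by
        rw [Finset.mul_sum]
        exact Finset.sum_congr rfl fun v hv => by rw [h1 v hv]

end Reprogramming

/-! ### Reprogramming block ciphers -/

section CipherReprogramming

open Finset Equiv
open scoped BigOperators

variable {m n : ℕ}

/-- The keys `(k₀, k₁, k₂)` of the construction. -/
abbrev FXKey (m n : ℕ) : Type := Bits m × Bits n × Bits n

/-- The key for which the construction from the inverse block cipher is the inverse of the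
construction with the key `K`. -/
def FXKey.dual (K : FXKey m n) : FXKey m n := (K.1, K.2.2, K.2.1)

/-- The input-output pairs of `E_{k₀}` that correspond to input-output pairs of the construction. -/
def unmask (K : FXKey m n) (T : List (Bits n × Bits n)) : List (Bits n × Bits n) :=
  T.map fun p => (p.1 + K.2.1, p.2 + K.2.2)

/-- The block cipher `E`, reprogrammed at the key `k₀` so that the construction with key `K` maps
`x` to `y` for all `(x, y)` in the transcript `T`. -/
def reprogramCipher (T : List (Bits n × Bits n)) (K : FXKey m n) (E : BlockCipher m n) :
    BlockCipher m n :=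
  Function.update E K.1 (reprogram (unmask K T) (E K.1))

/-- The block cipher that swaps `a` and `b` at the key `k` and is the identity at all other keys. -/
def swapAt (k : Bits m) (a b : Bits n) : BlockCipher m n := Pi.mulSingle k (swap a b)

lemma swapAt_mul_self (k : Bits m) (a b : Bits n) : swapAt k a b * swapAt k a b = 1 := by
  rw [swapAt, ← Pi.mulSingle_mul, swap_mul_self, Pi.mulSingle_one]

lemma swapAt_inv (k : Bits m) (a b : Bits n) : (swapAt k a b)⁻¹ = swapAt k a b :=
  inv_eq_of_mul_eq_one_left (swapAt_mul_self k a b)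

@[simp] lemma reprogramCipher_nil (K : FXKey m n) (E : BlockCipher m n) :
    reprogramCipher [] K E = E := by
  simp [reprogramCipher, unmask]

lemma isPartialInj_unmask {T : List (Bits n × Bits n)} (hT : IsPartialInj T) (K : FXKey m n) :
    IsPartialInj (unmask K T) := by
  unfold IsPartialInj unmask
  rw [List.pairwise_map]
  exact List.Pairwise.imp (fun h => ⟨by simpa using h.1, by simpa using h.2⟩) hT

lemma add_mem_freeInputs_unmask {T : List (Bits n × Bits n)} (K : FXKey m n) {x : Bits n} :
    x + K.2.1 ∈ freeInputs (unmask K T) ↔ x ∈ freeInputs T := by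
  simp only [mem_freeInputs, unmask, List.forall_mem_map, ne_eq, add_left_inj]

lemma add_mem_freeOutputs_unmask {T : List (Bits n × Bits n)} (K : FXKey m n) {y : Bits n} :
    y + K.2.2 ∈ freeOutputs (unmask K T) ↔ y ∈ freeOutputs T := by
  simp only [mem_freeOutputs, unmask, List.forall_mem_map, ne_eq, add_left_inj]

lemma reprogramCipher_self (T : List (Bits n × Bits n)) (K : FXKey m n) (E : BlockCipher m n) :
    reprogramCipher T K E K.1 = reprogram (unmask K T) (E K.1) := by
  simp [reprogramCipher]

lemma reprogramCipher_of_ne (T : List (Bits n × Bits n)) {K : FXKey m n} {k : Bits m}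
    (hk : k ≠ K.1) (E : BlockCipher m n) : reprogramCipher T K E k = E k := by
  simp [reprogramCipher, hk]

lemma fxCipher_reprogramCipher_apply {T : List (Bits n × Bits n)} (hT : IsPartialInj T)
    (K : FXKey m n) (E : BlockCipher m n) {p : Bits n × Bits n} (hp : p ∈ T) :
    fxCipher (reprogramCipher T K E) K.1 K.2.1 K.2.2 p.1 = p.2 := by
  have h := reprogram_apply (isPartialInj_unmask hT K) (E K.1)
    (p := (p.1 + K.2.1, p.2 + K.2.2)) (List.mem_map_of_mem hp)
  change reprogramCipher T K E K.1 (p.1 + K.2.1) + K.2.2 = p.2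
  rw [reprogramCipher_self, h, add_assoc, ZModModule.add_self, add_zero]

lemma unmask_dual (K : FXKey m n) (T : List (Bits n × Bits n)) :
    unmask K.dual (T.map Prod.swap) = (unmask K T).map Prod.swap := by
  simp [unmask, FXKey.dual, Function.comp_def]

lemma reprogramCipher_inv (T : List (Bits n × Bits n)) (K : FXKey m n) (E : BlockCipher m n) :
    (reprogramCipher T K E)⁻¹ = reprogramCipher (T.map Prod.swap) K.dual E⁻¹ := by
  ext1 k
  by_cases hk : k = K.1
  · subst hk
    rw [Pi.inv_apply, reprogramCipher_self, reprogram_inv, ← unmask_dual]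
    exact (reprogramCipher_self (T.map Prod.swap) K.dual E⁻¹).symm
  · rw [Pi.inv_apply, reprogramCipher_of_ne T hk,
      reprogramCipher_of_ne _ (K := K.dual) (by exact hk), Pi.inv_apply]

/-- The involution `K ↦ K.dual` on keys. -/
def FXKey.dualEquiv (m n : ℕ) : FXKey m n ≃ FXKey m n :=
  ⟨FXKey.dual, FXKey.dual, fun _ => rfl, fun _ => rfl⟩

lemma expect_inv_eq {G : Type*} [Group G] [Fintype G] (f : G → ℝ) : 𝔼 g, f g⁻¹ = 𝔼 g, f g :=
  Fintype.expect_equiv (Equiv.inv G) _ _ fun _ => rfl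

lemma expect_mul_right_eq {G : Type*} [Group G] [Fintype G] (f : G → ℝ) (a : G) :
    𝔼 g, f (g * a) = 𝔼 g, f g :=
  Fintype.expect_equiv (Equiv.mulRight a) _ _ fun _ => rfl

/-- Replacing the block cipher by its inverse, and exchanging the outer keys, preserves the
uniform distribution. -/
lemma expect_dual (g : BlockCipher m n → FXKey m n → ℝ) :
    𝔼 E, 𝔼 K : FXKey m n, g E⁻¹ K.dual = 𝔼 E, 𝔼 K, g E K := by
  rw [← expect_inv_eq fun E => 𝔼 K, g E K]
  exact Finset.expect_congr rfl fun E _ =>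
    Fintype.expect_equiv (FXKey.dualEquiv m n) _ _ fun _ => rfl

/-- The analogue of `expect_reprogram_cons` for block ciphers: the swap takes place at the key
`k₀`, between the masked query and a masked free point. -/
lemma expect_reprogramCipher_cons {T : List (Bits n × Bits n)} (hT : IsPartialInj T)
    {x : Bits n} (hx : x ∈ freeInputs T) (K : FXKey m n) (E : BlockCipher m n)
    (h : BlockCipher m n → ℝ) :
    𝔼 y ∈ freeOutputs T, h (reprogramCipher ((x, y) :: T) K E) =
      𝔼 x' ∈ freeInputs T,
        h (reprogramCipher T K (E * swapAt K.1 (x + K.2.1) (x' + K.2.1))) := by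
  have key := expect_reprogram_cons (isPartialInj_unmask hT K)
    ((add_mem_freeInputs_unmask K).2 hx) (E K.1) fun F => h (Function.update E K.1 F)
  calc 𝔼 y ∈ freeOutputs T, h (reprogramCipher ((x, y) :: T) K E)
      = 𝔼 v ∈ freeOutputs (unmask K T),
          h (Function.update E K.1 (reprogram ((x + K.2.1, v) :: unmask K T) (E K.1))) :=
        Finset.expect_equiv (Equiv.addRight K.2.2)
          (fun y => (add_mem_freeOutputs_unmask K).symm) fun y _ => rfl
    _ = _ := key
    _ = _ := by
        symm
        refine Finset.expect_equiv (Equiv.addRight K.2.1)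
          (fun y => (add_mem_freeInputs_unmask K).symm) fun x' _ => ?_
        congr 1
        ext1 k
        by_cases hk : k = K.1
        · subst hk
          rw [reprogramCipher_self, Function.update_self]
          simp [swapAt]
        · rw [reprogramCipher_of_ne _ hk, Function.update_of_ne hk]
          simp [swapAt, hk]

/-- With a fresh random answer to a fresh query, the reprogrammed cipher has the same distribution
as before, for every key. -/
lemma expect_expect_reprogramCipher_cons {T : List (Bits n × Bits n)} (hT : IsPartialInj T)
    {x : Bits n} (hx : x ∈ freeInputs T) (h : FXKey m n → BlockCipher m n → ℝ) :
    𝔼 y ∈ freeOutputs T, 𝔼 E, 𝔼 K, h K (reprogramCipher ((x, y) :: T) K E) =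
      𝔼 E, 𝔼 K, h K (reprogramCipher T K E) := by
  have hne : (freeInputs T).Nonempty := ⟨x, hx⟩
  calc 𝔼 y ∈ freeOutputs T, 𝔼 E, 𝔼 K, h K (reprogramCipher ((x, y) :: T) K E)
      = 𝔼 K, 𝔼 E, 𝔼 y ∈ freeOutputs T, h K (reprogramCipher ((x, y) :: T) K E) := by
        rw [Finset.expect_comm]
        conv_lhs => enter [2, E]; rw [Finset.expect_comm]
        rw [Finset.expect_comm]
    _ = 𝔼 K : FXKey m n, 𝔼 E, 𝔼 x' ∈ freeInputs T,
          h K (reprogramCipher T K (E * swapAt K.1 (x + K.2.1) (x' + K.2.1))) := by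
        simp only [fun K E => expect_reprogramCipher_cons hT hx K E (h K)]
    _ = 𝔼 K : FXKey m n, 𝔼 x' ∈ freeInputs T, 𝔼 E,
          h K (reprogramCipher T K (E * swapAt K.1 (x + K.2.1) (x' + K.2.1))) := by
        refine Finset.expect_congr rfl fun K _ => Finset.expect_comm _ _ _
    _ = 𝔼 K : FXKey m n, 𝔼 x' ∈ freeInputs T, 𝔼 E, h K (reprogramCipher T K E) := by
        refine Finset.expect_congr rfl fun K _ => Finset.expect_congr rfl fun x' _ => ?_
        exact expect_mul_right_eq (fun E => h K (reprogramCipher T K E)) _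
    _ = 𝔼 E, 𝔼 K, h K (reprogramCipher T K E) := by
        simp only [Finset.expect_const hne]
        rw [Finset.expect_comm]

lemma expect_expect_reprogramCipher_cons_inv {T : List (Bits n × Bits n)} (hT : IsPartialInj T)
    {y : Bits n} (hy : y ∈ freeOutputs T) (h : FXKey m n → BlockCipher m n → ℝ) :
    𝔼 x ∈ freeInputs T, 𝔼 E, 𝔼 K, h K (reprogramCipher ((x, y) :: T) K E) =
      𝔼 E, 𝔼 K, h K (reprogramCipher T K E) := by
  have key := expect_expect_reprogramCipher_cons (m := m) hT.map_swap (x := y)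
    (by rwa [freeInputs_map_swap]) fun K E => h K.dual E⁻¹
  rw [freeOutputs_map_swap] at key
  have hdual : ∀ U : List (Bits n × Bits n), 𝔼 E, 𝔼 K, h K (reprogramCipher U K E) =
      𝔼 E, 𝔼 K : FXKey m n, h K.dual (reprogramCipher (U.map Prod.swap) K E)⁻¹ := by
    intro U
    rw [← expect_dual]
    refine Finset.expect_congr rfl fun E _ => Finset.expect_congr rfl fun K _ => ?_
    rw [← inv_inv (reprogramCipher U K.dual E⁻¹), reprogramCipher_inv]
    simp [FXKey.dual]
  simp only [hdual]
  exact key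

/-- For a uniformly random permutation, conditioning on a further input-output pair with a random
fresh output does not change the distribution. -/
lemma expect_expect_reprogram_cons {α : Type*} [DecidableEq α] [Fintype α] {T : List (α × α)}
    (hT : IsPartialInj T) {x : α} (hx : x ∈ freeInputs T) (h : Perm α → ℝ) :
    𝔼 y ∈ freeOutputs T, 𝔼 R, h (reprogram ((x, y) :: T) R) = 𝔼 R, h (reprogram T R) := by
  have hne : (freeInputs T).Nonempty := ⟨x, hx⟩
  rw [Finset.expect_comm]
  simp only [fun R => expect_reprogram_cons hT hx R h]
  rw [Finset.expect_comm]
  refine (Finset.expect_congr rfl fun x' _ => ?_).trans (Finset.expect_const hne _)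
  exact expect_mul_right_eq (fun R => h (reprogram T R)) _

lemma expect_expect_reprogram_cons_inv {α : Type*} [DecidableEq α] [Fintype α] {T : List (α × α)}
    (hT : IsPartialInj T) {y : α} (hy : y ∈ freeOutputs T) (h : Perm α → ℝ) :
    𝔼 x ∈ freeInputs T, 𝔼 R, h (reprogram ((x, y) :: T) R) = 𝔼 R, h (reprogram T R) := by
  have key := expect_expect_reprogram_cons hT.map_swap (x := y)
    (by rwa [freeInputs_map_swap]) fun F => h F⁻¹
  rw [freeOutputs_map_swap] at key
  have hinv : ∀ U : List (α × α), 𝔼 R, h (reprogram U R) =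
      𝔼 R, h (reprogram (U.map Prod.swap) R)⁻¹ := by
    intro U
    rw [← expect_inv_eq]
    refine Finset.expect_congr rfl fun R _ => ?_
    rw [← inv_inv (reprogram U R⁻¹), reprogram_inv, inv_inv]
  simp only [hinv]
  exact key

/-! ### Distances between the ideal and the real run -/

variable {H : Type*}

/-- The states of the run in which the block cipher is replaced by its inverse. -/
def dualFamily (ψ : BlockCipher m n → H) : BlockCipher m n → H := fun E => ψ E⁻¹

variable [NormedAddCommGroup H]

/-- The mean square norm of the state of the ideal run, in which the state after a given transcript
is a function `ψ` of the block cipher. -/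
noncomputable def weight (ψ : BlockCipher m n → H) : ℝ := 𝔼 E, ‖ψ E‖ ^ 2

/-- The mean square norm of the state of the real run after the transcript `T`. -/
noncomputable def realWeight (T : List (Bits n × Bits n)) (ψ : BlockCipher m n → H) : ℝ :=
  𝔼 E, 𝔼 K, ‖ψ (reprogramCipher T K E)‖ ^ 2

/-- The mean square distance between the states of the ideal run with block cipher `E` and of the
real run with the reprogrammed block cipher. -/
noncomputable def deviation (T : List (Bits n × Bits n)) (ψ : BlockCipher m n → H) : ℝ :=
  𝔼 E, 𝔼 K, ‖ψ E - ψ (reprogramCipher T K E)‖ ^ 2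

/-- How much the state depends on the block cipher: the mean square change of the state when two
random values at a random key are exchanged. -/
noncomputable def spread (ψ : BlockCipher m n → H) : ℝ :=
  𝔼 k, 𝔼 a, 𝔼 b, 𝔼 E, ‖ψ E - ψ (E * swapAt k a b)‖ ^ 2

lemma weight_dualFamily (ψ : BlockCipher m n → H) : weight (dualFamily ψ) = weight ψ :=
  expect_inv_eq fun E => ‖ψ E‖ ^ 2

lemma deviation_dualFamily (T : List (Bits n × Bits n)) (ψ : BlockCipher m n → H) :
    deviation (T.map Prod.swap) (dualFamily ψ) = deviation T ψ := by
  unfold deviation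
  rw [← expect_dual]
  refine Finset.expect_congr rfl fun E _ => Finset.expect_congr rfl fun K _ => ?_
  rw [← reprogramCipher_inv]
  simp [dualFamily]

lemma spread_dualFamily (ψ : BlockCipher m n → H) : spread (dualFamily ψ) = spread ψ := by
  unfold spread dualFamily
  refine Finset.expect_congr rfl fun k _ => ?_
  calc 𝔼 a, 𝔼 b, 𝔼 E : BlockCipher m n, ‖ψ E⁻¹ - ψ (E * swapAt k a b)⁻¹‖ ^ 2
      = 𝔼 a, 𝔼 b, 𝔼 E : BlockCipher m n, ‖ψ E - ψ (swapAt k a b * E)‖ ^ 2 := by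
        refine Finset.expect_congr rfl fun a _ => Finset.expect_congr rfl fun b _ => ?_
        rw [← expect_inv_eq fun E => ‖ψ E - ψ (swapAt k a b * E)‖ ^ 2]
        simp only [mul_inv_rev, swapAt_inv]
    _ = 𝔼 E : BlockCipher m n, 𝔼 a, 𝔼 b, ‖ψ E - ψ (swapAt k a b * E)‖ ^ 2 := by
        conv_lhs => enter [2, a]; rw [Finset.expect_comm]
        rw [Finset.expect_comm]
    _ = 𝔼 E : BlockCipher m n, 𝔼 a, 𝔼 b, ‖ψ E - ψ (E * swapAt k a b)‖ ^ 2 := by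
        refine Finset.expect_congr rfl fun E _ => ?_
        refine Fintype.expect_equiv (E k)⁻¹ _ _ fun a =>
          Fintype.expect_equiv (E k)⁻¹ _ _ fun b => ?_
        have : swapAt k a b * E = E * swapAt k ((E k)⁻¹ a) ((E k)⁻¹ b) := by
          ext1 l
          by_cases hl : l = k
          · subst hl; simp [swapAt, mul_swap_eq_swap_mul]
          · simp [swapAt, hl]
        rw [this]
    _ = _ := by
        rw [Finset.expect_comm]
        conv_lhs => enter [2, a]; rw [Finset.expect_comm]

lemma weight_nonneg (ψ : BlockCipher m n → H) : 0 ≤ weight ψ :=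
  Finset.expect_nonneg fun _ _ => sq_nonneg _

lemma deviation_nonneg (T : List (Bits n × Bits n)) (ψ : BlockCipher m n → H) :
    0 ≤ deviation T ψ :=
  Finset.expect_nonneg fun _ _ => Finset.expect_nonneg fun _ _ => sq_nonneg _

lemma spread_nonneg (ψ : BlockCipher m n → H) : 0 ≤ spread ψ :=
  Finset.expect_nonneg fun _ _ => Finset.expect_nonneg fun _ _ =>
    Finset.expect_nonneg fun _ _ => Finset.expect_nonneg fun _ _ => sq_nonneg _

lemma norm_add_sq_le_of_pos (a b : H) {κ : ℝ} (hκ : 0 < κ) :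
    ‖a + b‖ ^ 2 ≤ (1 + κ) * ‖a‖ ^ 2 + (1 + κ⁻¹) * ‖b‖ ^ 2 := by
  have h1 : ‖a + b‖ ^ 2 ≤ (‖a‖ + ‖b‖) ^ 2 := by gcongr; exact norm_add_le a b
  have h2 : 0 ≤ κ⁻¹ * (κ * ‖a‖ - ‖b‖) ^ 2 := by positivity
  have h3 : κ⁻¹ * (κ * ‖a‖ - ‖b‖) ^ 2 = κ * ‖a‖ ^ 2 - 2 * ‖a‖ * ‖b‖ + κ⁻¹ * ‖b‖ ^ 2 := by
    field_simp; ring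
  nlinarith

/-- A swap of the point queried with another free point moves the state by no more than the
spread, up to the proportion of free points. -/
lemma expect_swapAt_le_spread {s : Finset (Bits n)} {M : ℝ} (hM : 0 < M) (hs : M ≤ s.card)
    (x : Bits n) (ψ : BlockCipher m n → H) :
    𝔼 K : FXKey m n, 𝔼 x' ∈ s, 𝔼 E,
        ‖ψ (E * swapAt K.1 (x + K.2.1) (x' + K.2.1)) - ψ E‖ ^ 2 ≤
      (2 : ℝ) ^ n / M * spread ψ := by
  set Φ : Bits m → Bits n → Bits n → ℝ := fun k a b =>
    𝔼 E, ‖ψ E - ψ (E * swapAt k a b)‖ ^ 2 with hΦ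
  have hΦ0 : ∀ k a b, 0 ≤ Φ k a b := fun k a b => Finset.expect_nonneg fun _ _ => sq_nonneg _
  have h1 : ∀ K : FXKey m n, 𝔼 x' ∈ s, 𝔼 E,
        ‖ψ (E * swapAt K.1 (x + K.2.1) (x' + K.2.1)) - ψ E‖ ^ 2 ≤
      (2 : ℝ) ^ n / M * 𝔼 b, Φ K.1 (x + K.2.1) b := by
    intro K
    have h2 : 𝔼 b, Φ K.1 (x + K.2.1) b = 𝔼 b, Φ K.1 (x + K.2.1) (b + K.2.1) :=
      (Fintype.expect_equiv (Equiv.addRight K.2.1) _ _ fun _ => rfl).symm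
    rw [h2]
    have h5 : 𝔼 x' ∈ s, 𝔼 E, ‖ψ (E * swapAt K.1 (x + K.2.1) (x' + K.2.1)) - ψ E‖ ^ 2 =
        𝔼 x' ∈ s, Φ K.1 (x + K.2.1) (x' + K.2.1) :=
      Finset.expect_congr rfl fun x' _ => Finset.expect_congr rfl fun E _ => by
        rw [norm_sub_rev]
    rw [h5]
    rw [Finset.expect_eq_sum_div_card, Fintype.expect_eq_sum_div_card]
    have hcard : (Fintype.card (Bits n) : ℝ) = 2 ^ n := by simp
    rw [hcard]
    have h3 : ∑ x' ∈ s, Φ K.1 (x + K.2.1) (x' + K.2.1) ≤ ∑ x', Φ K.1 (x + K.2.1) (x' + K.2.1) :=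
      Finset.sum_le_univ_sum_of_nonneg fun _ => hΦ0 _ _ _
    have h4 : (0 : ℝ) ≤ ∑ x', Φ K.1 (x + K.2.1) (x' + K.2.1) :=
      Finset.sum_nonneg fun _ _ => hΦ0 _ _ _
    calc _ ≤ (∑ x', Φ K.1 (x + K.2.1) (x' + K.2.1)) / M := by gcongr
      _ = _ := by field_simp
  refine (Finset.expect_le_expect fun K _ => h1 K).trans ?_
  rw [← Finset.mul_expect]
  gcongr
  rw [← Finset.univ_product_univ, Finset.expect_product]
  simp only [spread]
  refine le_of_eq (Finset.expect_congr rfl fun k _ => ?_)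
  rw [← Finset.univ_product_univ, Finset.expect_product]
  simp only [Finset.expect_const (univ_nonempty (α := Bits n))]
  exact Fintype.expect_equiv (Equiv.addLeft x) _ _ fun _ => rfl

/-- A fresh classical query increases the deviation only through the dependence of the state on
the block cipher. -/
lemma expect_deviation_cons_le {T : List (Bits n × Bits n)} (hT : IsPartialInj T) {x : Bits n}
    (hx : x ∈ freeInputs T) (ψ : BlockCipher m n → H) {M κ : ℝ} (hM : 0 < M)
    (hMT : M + T.length ≤ 2 ^ n) (hκ : 0 < κ) :
    𝔼 y ∈ freeOutputs T, deviation ((x, y) :: T) ψ ≤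
      (1 + κ) * deviation T ψ + (1 + κ⁻¹) * ((2 : ℝ) ^ n / M * spread ψ) := by
  have hne : (freeInputs T).Nonempty := ⟨x, hx⟩
  have hcard : M ≤ (freeInputs T).card := by
    have h := card_le_card_freeInputs_add T
    have h' : ((2 ^ n : ℕ) : ℝ) ≤ ((freeInputs T).card + T.length : ℕ) := by
      refine Nat.cast_le.2 ((le_of_eq ?_).trans h)
      simp
    push_cast at h'
    linarith
  have hle : ∀ (K : FXKey m n) (x' : Bits n),
      𝔼 E, ‖ψ E - ψ (reprogramCipher T K (E * swapAt K.1 (x + K.2.1) (x' + K.2.1)))‖ ^ 2 ≤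
      (1 + κ) * (𝔼 E, ‖ψ E - ψ (reprogramCipher T K E)‖ ^ 2) +
        (1 + κ⁻¹) * 𝔼 E, ‖ψ (E * swapAt K.1 (x + K.2.1) (x' + K.2.1)) - ψ E‖ ^ 2 := by
    intro K x'
    calc _ = 𝔼 E, ‖ψ (E * swapAt K.1 (x + K.2.1) (x' + K.2.1)) -
          ψ (reprogramCipher T K E)‖ ^ 2 := by
          rw [← expect_mul_right_eq _ (swapAt K.1 (x + K.2.1) (x' + K.2.1))]
          simp only [mul_assoc, swapAt_mul_self, mul_one]
      _ ≤ 𝔼 E, ((1 + κ) * ‖ψ E - ψ (reprogramCipher T K E)‖ ^ 2 +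
          (1 + κ⁻¹) * ‖ψ (E * swapAt K.1 (x + K.2.1) (x' + K.2.1)) - ψ E‖ ^ 2) := by
          refine Finset.expect_le_expect fun E _ => ?_
          refine le_trans (le_of_eq ?_) (norm_add_sq_le_of_pos _ _ hκ)
          congr 2
          abel
      _ = _ := by rw [Finset.expect_add_distrib, Finset.mul_expect, Finset.mul_expect]
  calc 𝔼 y ∈ freeOutputs T, deviation ((x, y) :: T) ψ
      = 𝔼 K : FXKey m n, 𝔼 x' ∈ freeInputs T, 𝔼 E,
          ‖ψ E - ψ (reprogramCipher T K (E * swapAt K.1 (x + K.2.1) (x' + K.2.1)))‖ ^ 2 := by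
        simp only [deviation]
        rw [Finset.expect_comm]
        conv_lhs => enter [2, E]; rw [Finset.expect_comm]
        simp only [fun K E => expect_reprogramCipher_cons hT hx K E fun E' => ‖ψ E - ψ E'‖ ^ 2]
        rw [Finset.expect_comm]
        exact Finset.expect_congr rfl fun K _ => Finset.expect_comm _ _ _
    _ ≤ 𝔼 K : FXKey m n, 𝔼 x' ∈ freeInputs T,
          ((1 + κ) * (𝔼 E, ‖ψ E - ψ (reprogramCipher T K E)‖ ^ 2) +
        (1 + κ⁻¹) * 𝔼 E, ‖ψ (E * swapAt K.1 (x + K.2.1) (x' + K.2.1)) - ψ E‖ ^ 2) :=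
        Finset.expect_le_expect fun K _ => Finset.expect_le_expect fun x' _ => hle K x'
    _ = (1 + κ) * deviation T ψ + (1 + κ⁻¹) * 𝔼 K : FXKey m n, 𝔼 x' ∈ freeInputs T, 𝔼 E,
          ‖ψ (E * swapAt K.1 (x + K.2.1) (x' + K.2.1)) - ψ E‖ ^ 2 := by
        simp only [Finset.expect_add_distrib, ← Finset.mul_expect, Finset.expect_const hne]
        rw [Finset.expect_comm]
        rfl
    _ ≤ _ := by
        gcongr
        exact expect_swapAt_le_spread hM hcard x ψ

lemma expect_deviation_cons_inv_le {T : List (Bits n × Bits n)} (hT : IsPartialInj T) {y : Bits n}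
    (hy : y ∈ freeOutputs T) (ψ : BlockCipher m n → H) {M κ : ℝ} (hM : 0 < M)
    (hMT : M + T.length ≤ 2 ^ n) (hκ : 0 < κ) :
    𝔼 x ∈ freeInputs T, deviation ((x, y) :: T) ψ ≤
      (1 + κ) * deviation T ψ + (1 + κ⁻¹) * ((2 : ℝ) ^ n / M * spread ψ) := by
  have key := expect_deviation_cons_le hT.map_swap (x := y) (by rwa [freeInputs_map_swap])
    (dualFamily ψ) hM (by simpa using hMT) hκ
  rw [freeOutputs_map_swap, deviation_dualFamily, spread_dualFamily] at key
  refine (le_of_eq (Finset.expect_congr rfl fun x _ => ?_)).trans key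
  rw [← deviation_dualFamily]
  rfl

end CipherReprogramming

/-! ### The quantum oracle and shift defects -/

section ShiftDefect

open Finset Equiv
open scoped BigOperators

variable {m n : ℕ} {W : Type*} [Fintype W]

/-- The squared norm of the component of `ψ` with key register `k` and input register `x`. -/
noncomputable def blockNormSq (ψ : QState m n W) (k : Bits m) (x : Bits n) : ℝ :=
  ∑ w, ∑ y, ‖ψ (w, k, x, y)‖ ^ 2

/-- Half the squared distance between the component of `ψ` with key register `k` and input register
`x` and its translate by `d` in the output register. -/
noncomputable def shiftDefect (ψ : QState m n W) (k : Bits m) (x d : Bits n) : ℝ :=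
  2⁻¹ * ∑ w, ∑ y, ‖ψ (w, k, x, y) - ψ (w, k, x, y + d)‖ ^ 2

/-- The real inner product of the differences of `ψ` and `φ` with their translates by `d`. -/
noncomputable def shiftForm (ψ φ : QState m n W) (k : Bits m) (x d : Bits n) : ℝ :=
  ∑ w, ∑ y, inner ℝ (ψ (w, k, x, y) - ψ (w, k, x, y + d)) (φ (w, k, x, y) - φ (w, k, x, y + d))

lemma norm_sq_eq_sum_blockNormSq (ψ : QState m n W) :
    ‖ψ‖ ^ 2 = ∑ k, ∑ x, blockNormSq ψ k x := by
  simp only [EuclideanSpace.norm_sq_eq, blockNormSq, Fintype.sum_prod_type]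
  rw [Finset.sum_comm]
  exact Finset.sum_congr rfl fun k _ => Finset.sum_comm

lemma blockNormSq_nonneg (ψ : QState m n W) (k : Bits m) (x : Bits n) : 0 ≤ blockNormSq ψ k x :=
  Finset.sum_nonneg fun _ _ => Finset.sum_nonneg fun _ _ => sq_nonneg _

lemma sum_blockNormSq_le (ψ : QState m n W) (k : Bits m) :
    ∑ x, blockNormSq ψ k x ≤ ‖ψ‖ ^ 2 := by
  rw [norm_sq_eq_sum_blockNormSq]
  exact Finset.single_le_sum (f := fun k => ∑ x, blockNormSq ψ k x)
    (fun k _ => Finset.sum_nonneg fun x _ => blockNormSq_nonneg ψ k x) (mem_univ k)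

lemma expect_sum_blockNormSq (ψ : QState m n W) :
    𝔼 k, ∑ x, blockNormSq ψ k x = ‖ψ‖ ^ 2 / 2 ^ m := by
  rw [Fintype.expect_eq_sum_div_card, ← norm_sq_eq_sum_blockNormSq]
  simp

/-- The properties of the function `d ↦ shiftDefect ψ k x d` used below, `c` being the squared norm
of the component: the trivial bound is `2 * c`, but on average over the shift the defect is at most
`c`. -/
structure IsDefect (g : Bits n → ℝ) (c : ℝ) : Prop where
  nonneg : ∀ d, 0 ≤ g d
  zero : g 0 = 0
  le : ∀ d, g d ≤ 2 * c
  expect_le : 𝔼 d, g d ≤ c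

lemma IsDefect.const_nonneg {g : Bits n → ℝ} {c : ℝ} (hg : IsDefect g c) : 0 ≤ c := by
  have := hg.nonneg 0
  have := hg.le 0
  linarith

lemma IsDefect.expect_add_le {g : Bits n → ℝ} {c : ℝ} (hg : IsDefect g c) (a : Bits n) :
    𝔼 d, g (a + d) ≤ c :=
  (Fintype.expect_equiv (Equiv.addLeft a) _ g fun _ => rfl).trans_le hg.expect_le

lemma isDefect_shiftDefect (ψ : QState m n W) (k : Bits m) (x : Bits n) :
    IsDefect (shiftDefect ψ k x) (blockNormSq ψ k x) := by
  have hshift : ∀ (w : W) (d : Bits n),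
      ∑ y, ‖ψ (w, k, x, y + d)‖ ^ 2 = ∑ y, ‖ψ (w, k, x, y)‖ ^ 2 := fun w d =>
    Fintype.sum_equiv (Equiv.addRight d) _ _ fun _ => rfl
  refine ⟨fun d => ?_, ?_, fun d => ?_, ?_⟩
  · exact mul_nonneg (by norm_num)
      (Finset.sum_nonneg fun _ _ => Finset.sum_nonneg fun _ _ => sq_nonneg _)
  · simp [shiftDefect]
  · have h : ∀ w : W, ∑ y, ‖ψ (w, k, x, y) - ψ (w, k, x, y + d)‖ ^ 2 ≤
        4 * ∑ y, ‖ψ (w, k, x, y)‖ ^ 2 := by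
      intro w
      calc _ ≤ ∑ y, (2 * ‖ψ (w, k, x, y)‖ ^ 2 + 2 * ‖ψ (w, k, x, y + d)‖ ^ 2) := by
            refine Finset.sum_le_sum fun y _ => ?_
            nlinarith [parallelogram_law_with_norm ℝ (ψ (w, k, x, y)) (ψ (w, k, x, y + d)),
              sq_nonneg ‖ψ (w, k, x, y) + ψ (w, k, x, y + d)‖]
        _ = _ := by
            rw [Finset.sum_add_distrib, ← Finset.mul_sum, ← Finset.mul_sum, hshift]
            ring
    calc shiftDefect ψ k x d ≤ 2⁻¹ * ∑ w, 4 * ∑ y, ‖ψ (w, k, x, y)‖ ^ 2 := by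
          unfold shiftDefect
          gcongr with w
          exact h w
      _ = _ := by
          rw [← Finset.mul_sum, blockNormSq]
          ring
  · -- the mean of `‖a - b‖ ^ 2` over all pairs of entries is at most twice the mean square
    have h : ∀ w : W, ∑ d, ∑ y, ‖ψ (w, k, x, y) - ψ (w, k, x, y + d)‖ ^ 2 ≤
        2 * 2 ^ n * ∑ y, ‖ψ (w, k, x, y)‖ ^ 2 := by
      intro w
      set a : Bits n → ℂ := fun y => ψ (w, k, x, y)
      have h1 : ∑ d, ∑ y, ‖a y - a (y + d)‖ ^ 2 = ∑ y, ∑ z, ‖a y - a z‖ ^ 2 := by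
        rw [Finset.sum_comm]
        exact Finset.sum_congr rfl fun y _ =>
          Fintype.sum_equiv (Equiv.addLeft y) _ _ fun _ => rfl
      have h2 : ∑ y, ∑ z, ‖a y - a z‖ ^ 2 =
          2 * 2 ^ n * ∑ y, ‖a y‖ ^ 2 - 2 * ‖∑ y, a y‖ ^ 2 := by
        have hin : ‖∑ y, a y‖ ^ 2 = ∑ y, ∑ z, inner ℝ (a y) (a z) := by
          rw [← real_inner_self_eq_norm_sq, sum_inner]
          simp only [inner_sum]
        simp only [norm_sub_sq_real, Finset.sum_add_distrib, Finset.sum_sub_distrib,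
          ← Finset.mul_sum, hin, Finset.sum_const, card_univ, nsmul_eq_mul]
        simp
        ring
      change ∑ d, ∑ y, ‖a y - a (y + d)‖ ^ 2 ≤ _
      rw [h1, h2]
      nlinarith [sq_nonneg ‖∑ y, a y‖]
    rw [Fintype.expect_eq_sum_div_card]
    have hcard : (Fintype.card (Bits n) : ℝ) = 2 ^ n := by simp
    rw [hcard, div_le_iff₀ (by positivity)]
    calc ∑ d, shiftDefect ψ k x d
        = 2⁻¹ * ∑ w, ∑ d, ∑ y, ‖ψ (w, k, x, y) - ψ (w, k, x, y + d)‖ ^ 2 := by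
          simp only [shiftDefect]
          rw [← Finset.mul_sum, Finset.sum_comm]
      _ ≤ 2⁻¹ * ∑ w, 2 * 2 ^ n * ∑ y, ‖ψ (w, k, x, y)‖ ^ 2 := by
          gcongr with w
          exact h w
      _ = _ := by
          rw [← Finset.mul_sum, blockNormSq]
          ring

lemma quantumOracle_apply (f : Bits m → Bits n → Bits n) (ψ : QState m n W) (w : W) (k : Bits m)
    (x y : Bits n) : quantumOracle f ψ (w, k, x, y) = ψ (w, k, x, y + f k x) := by
  simp [quantumOracle, queryPerm, LinearIsometryEquiv.piLpCongrLeft_apply, ZModModule.sub_eq_add]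

/-- Translations by bit strings are involutions, so the change in the squared distance of two
states, when the oracles of two functions are applied to them, is an inner product of
differences. -/
lemma norm_quantumOracle_sub_sq (f g : Bits m → Bits n → Bits n) (ψ φ : QState m n W) :
    ‖quantumOracle f ψ - quantumOracle g φ‖ ^ 2 =
      ‖ψ - φ‖ ^ 2 + ∑ k, ∑ x, shiftForm ψ φ k x (f k x + g k x) := by
  rw [norm_sq_eq_sum_blockNormSq, norm_sq_eq_sum_blockNormSq, ← Finset.sum_add_distrib]
  refine Finset.sum_congr rfl fun k _ => ?_
  rw [← Finset.sum_add_distrib]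
  refine Finset.sum_congr rfl fun x _ => ?_
  simp only [blockNormSq, shiftForm, PiLp.sub_apply, quantumOracle_apply]
  rw [← Finset.sum_add_distrib]
  refine Finset.sum_congr rfl fun w _ => ?_
  set a : Bits n → ℂ := fun y => ψ (w, k, x, y)
  set b : Bits n → ℂ := fun y => φ (w, k, x, y)
  set d := f k x + g k x
  change ∑ y, ‖a (y + f k x) - b (y + g k x)‖ ^ 2 =
    ∑ y, ‖a y - b y‖ ^ 2 + ∑ y, inner ℝ (a y - a (y + d)) (b y - b (y + d))
  have h1 : ∑ y, ‖a (y + f k x) - b (y + g k x)‖ ^ 2 = ∑ y, ‖a y - b (y + d)‖ ^ 2 := by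
    refine Fintype.sum_equiv (Equiv.addRight (f k x)) _ _ fun y => ?_
    have : y + f k x + d = y + g k x := by
      simp only [d]
      rw [add_assoc, ← add_assoc (f k x), ZModModule.add_self, zero_add]
    simp [this]
  have h2 : ∑ y, ‖a y - b (y + d)‖ ^ 2 = ∑ y, ‖a (y + d) - b y‖ ^ 2 := by
    refine Fintype.sum_equiv (Equiv.addRight d) _ _ fun y => ?_
    simp [add_assoc, ZModModule.add_self]
  have h3 : ∑ y, ‖a (y + d) - b (y + d)‖ ^ 2 = ∑ y, ‖a y - b y‖ ^ 2 :=
    Fintype.sum_equiv (Equiv.addRight d) _ _ fun y => rfl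
  have h4 : ∑ y, ‖a y - b (y + d)‖ ^ 2 + ∑ y, ‖a (y + d) - b y‖ ^ 2 =
      ∑ y, ‖a y - b y‖ ^ 2 + ∑ y, ‖a (y + d) - b (y + d)‖ ^ 2 +
        2 * ∑ y, inner ℝ (a y - a (y + d)) (b y - b (y + d)) := by
    rw [Finset.mul_sum, ← Finset.sum_add_distrib, ← Finset.sum_add_distrib,
      ← Finset.sum_add_distrib]
    refine Finset.sum_congr rfl fun y _ => ?_
    simp only [norm_sub_sq_real, inner_sub_left, inner_sub_right]
    ring
  linarith

lemma shiftForm_le (ψ φ : QState m n W) (k : Bits m) (x d : Bits n) {κ : ℝ} (hκ : 0 < κ) :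
    shiftForm ψ φ k x d ≤ κ⁻¹ * shiftDefect ψ k x d + κ * shiftDefect φ k x d := by
  simp only [shiftForm, shiftDefect, Finset.mul_sum, ← Finset.sum_add_distrib]
  refine Finset.sum_le_sum fun w _ => Finset.sum_le_sum fun y _ => ?_
  set a := ψ (w, k, x, y) - ψ (w, k, x, y + d)
  set b := φ (w, k, x, y) - φ (w, k, x, y + d)
  have h1 := real_inner_le_norm a b
  have h2 : 0 ≤ κ⁻¹ * (‖a‖ - κ * ‖b‖) ^ 2 := by positivity
  have h3 : κ⁻¹ * (‖a‖ - κ * ‖b‖) ^ 2 = κ⁻¹ * ‖a‖ ^ 2 - 2 * ‖a‖ * ‖b‖ + κ * ‖b‖ ^ 2 := by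
    field_simp; ring
  nlinarith

/-- The inner product with `φ` is split into those with `χ` and with `φ - χ`. For a good choice of
`χ` close to `φ`, the shift `d` is random given `χ`. -/
lemma shiftForm_le_add_sub (ψ φ χ : QState m n W) (k : Bits m) (x d : Bits n) {κ : ℝ} (hκ : 0 < κ) :
    shiftForm ψ φ k x d ≤ (1 + κ⁻¹) * shiftDefect ψ k x d +
      (shiftDefect χ k x d + κ * shiftDefect (φ - χ) k x d) := by
  have h1 := shiftForm_le ψ χ k x d one_pos
  have h2 := shiftForm_le ψ (φ - χ) k x d hκ
  have h3 : shiftForm ψ φ k x d = shiftForm ψ χ k x d + shiftForm ψ (φ - χ) k x d := by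
    simp only [shiftForm, ← Finset.sum_add_distrib, ← inner_add_right, PiLp.sub_apply]
    refine Finset.sum_congr rfl fun w _ => Finset.sum_congr rfl fun y _ => ?_
    congr 1
    ring
  rw [h3]
  simp only [inv_one, one_mul] at h1
  linarith

end ShiftDefect

/-! ### Averages over swaps, keys and fibres -/

section Averages

open Finset Equiv
open scoped BigOperators

variable {m n : ℕ}

/-- A swap of two random points changes the value at a given point with small probability, and
then to a random value. -/
lemma expect_swap_defect_le {g : Bits n → Bits n → ℝ} {c : Bits n → ℝ}
    (hg : ∀ x, IsDefect (g x) (c x)) (F : Perm (Bits n)) :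
    𝔼 a, 𝔼 b, ∑ x, g x (F x + (F * swap a b : Perm (Bits n)) x) ≤ 2 / 2 ^ n * ∑ x, c x := by
  have hcard : (Fintype.card (Bits n) : ℝ) = 2 ^ n := by simp
  have h1 : ∀ a b x, g x (F x + (F * swap a b : Perm (Bits n)) x) ≤
      (if x = a then g x (F x + F b) else 0) + (if x = b then g x (F x + F a) else 0) := by
    intro a b x
    have n1 := (hg x).nonneg (F x + F a)
    have n2 := (hg x).nonneg (F x + F b)
    rw [Perm.mul_apply]
    by_cases ha : x = a
    · subst ha
      simp only [swap_apply_left, if_true]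
      split_ifs
      all_goals linarith
    by_cases hb : x = b
    · subst hb
      simp only [swap_apply_right, if_true]
      split_ifs
      all_goals linarith
    simp [swap_apply_of_ne_of_ne ha hb, ha, hb, ZModModule.add_self, (hg x).zero]
  have hF : ∀ x, 𝔼 b, g x (F x + F b) ≤ c x := fun x =>
    (Fintype.expect_equiv F _ (fun d => g x (F x + d)) fun _ => rfl).trans_le
      ((hg x).expect_add_le _)
  have h2 : 𝔼 a, 𝔼 b, ∑ x, (if x = a then g x (F x + F b) else 0) ≤ 1 / 2 ^ n * ∑ x, c x := by
    simp only [Finset.sum_ite_eq', mem_univ, if_true]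
    rw [Fintype.expect_eq_sum_div_card, hcard, div_eq_inv_mul, one_div]
    gcongr with x
    exact hF x
  calc _ ≤ 𝔼 a, 𝔼 b, ∑ x, ((if x = a then g x (F x + F b) else 0) +
        (if x = b then g x (F x + F a) else 0)) :=
        Finset.expect_le_expect fun a _ => Finset.expect_le_expect fun b _ =>
          Finset.sum_le_sum fun x _ => h1 a b x
    _ = 𝔼 a, 𝔼 b, ∑ x, (if x = a then g x (F x + F b) else 0) +
        𝔼 a, 𝔼 b, ∑ x, (if x = b then g x (F x + F a) else 0) := by
        simp only [Finset.sum_add_distrib, Finset.expect_add_distrib]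
    _ = 𝔼 a, 𝔼 b, ∑ x, (if x = a then g x (F x + F b) else 0) +
        𝔼 a, 𝔼 b, ∑ x, (if x = a then g x (F x + F b) else 0) := by
        congr 1
        rw [Finset.expect_comm]
    _ ≤ _ := by
        refine (add_le_add h2 h2).trans (le_of_eq ?_)
        ring

lemma expect_ite_eq_add (c : ℝ) (x a : Bits n) :
    𝔼 k, (if x = a + k then c else 0) = c / 2 ^ n := by
  have h : ∀ k : Bits n, (x = a + k) ↔ (k = a + x) := by
    intro k
    constructor
    · rintro rfl; rw [← add_assoc, ZModModule.add_self, zero_add]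
    · rintro rfl; rw [← add_assoc, ZModModule.add_self, zero_add]
  simp only [h]
  rw [Fintype.expect_eq_sum_div_card]
  simp

lemma expect_expect_listSum_le {ι : Type*} (T : List ι) (h : ι → Bits n → Bits n → ℝ) {B : ℝ}
    (hB : ∀ p ∈ T, 𝔼 k₁, 𝔼 k₂, h p k₁ k₂ ≤ B) :
    𝔼 k₁, 𝔼 k₂, (T.map fun p => h p k₁ k₂).sum ≤ T.length * B := by
  induction T with
  | nil => simp
  | cons p T ih =>
    have h1 := ih fun q hq => hB q (List.mem_cons_of_mem _ hq)
    have h2 := hB p List.mem_cons_self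
    simp only [List.map_cons, List.sum_cons, Finset.expect_add_distrib, List.length_cons]
    push_cast
    linarith

/-- For a fixed cipher and random outer keys, a value changes under the reprogramming with
probability at most `2 * T.length / 2 ^ n`. In the case that the point itself is constrained, the
new value is random and the defect is `c` on average; in the case that its value is taken, the
defect is at most `2 * c`. -/
lemma expect_reprogram_defect_le {T : List (Bits n × Bits n)} (hT : IsPartialInj T) (k₀ : Bits m)
    {g : Bits n → ℝ} {c : ℝ} (hg : IsDefect g c) (F : Perm (Bits n)) (x : Bits n) :
    𝔼 k₁, 𝔼 k₂, g (F x + reprogram (unmask (k₀, k₁, k₂) T) F x) ≤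
      3 * T.length / 2 ^ n * c := by
  have hc := hg.const_nonneg
  set h : Bits n × Bits n → Bits n → Bits n → ℝ := fun p k₁ k₂ =>
    (if x = p.1 + k₁ then g (F x + (p.2 + k₂)) else 0) + (if F x = p.2 + k₂ then 2 * c else 0)
    with hh
  have h0 : ∀ p k₁ k₂, 0 ≤ h p k₁ k₂ := by
    intro p k₁ k₂
    have := hg.nonneg (F x + (p.2 + k₂))
    simp only [hh]
    split_ifs <;> linarith
  have hle : ∀ k₁ k₂, ∀ p ∈ T, h p k₁ k₂ ≤ (T.map fun p => h p k₁ k₂).sum := by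
    intro k₁ k₂ p hp
    refine List.single_le_sum ?_ _ (List.mem_map_of_mem hp)
    simp only [List.mem_map, forall_exists_index, and_imp, forall_apply_eq_imp_iff₂]
    exact fun p _ => h0 p k₁ k₂
  have h1 : ∀ k₁ k₂, g (F x + reprogram (unmask (k₀, k₁, k₂) T) F x) ≤
      (T.map fun p => h p k₁ k₂).sum := by
    intro k₁ k₂
    by_cases hx : ∃ p ∈ T, x = p.1 + k₁
    · obtain ⟨p, hp, hxp⟩ := hx
      have h2 := reprogram_apply (isPartialInj_unmask hT (k₀, k₁, k₂)) F
        (p := (p.1 + k₁, p.2 + k₂)) (List.mem_map_of_mem hp)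
      simp only [← hxp] at h2
      refine le_trans ?_ (hle k₁ k₂ p hp)
      rw [h2]
      simp only [hh, if_pos hxp]
      split_ifs <;> linarith
    by_cases hy : ∃ p ∈ T, F x = p.2 + k₂
    · obtain ⟨p, hp, hyp⟩ := hy
      refine le_trans ((hg.le _).trans ?_) (hle k₁ k₂ p hp)
      have := hg.nonneg (F x + (p.2 + k₂))
      simp only [hh, if_pos hyp]
      split_ifs <;> linarith
    push Not at hx hy
    rw [reprogram_apply_of_notMem _ _ (by
        simp only [unmask, List.forall_mem_map]; exact fun p hp => (hx p hp).symm)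
      (by
        simp only [unmask, List.forall_mem_map]; exact fun p hp => (hy p hp).symm),
      ZModModule.add_self, hg.zero]
    refine List.sum_nonneg ?_
    simp only [List.mem_map, forall_exists_index, and_imp, forall_apply_eq_imp_iff₂]
    exact fun p _ => h0 p k₁ k₂
  calc _ ≤ 𝔼 k₁, 𝔼 k₂, (T.map fun p => h p k₁ k₂).sum :=
        Finset.expect_le_expect fun _ _ => Finset.expect_le_expect fun _ _ => h1 _ _
    _ ≤ T.length * (3 * c / 2 ^ n) := by
        refine expect_expect_listSum_le T h fun p _ => ?_
        simp only [hh, Finset.expect_add_distrib, expect_ite_eq_add]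
        have h3 : ∀ k₁ : Bits n, 𝔼 k₂, (if x = p.1 + k₁ then g (F x + (p.2 + k₂)) else 0) ≤
            if x = p.1 + k₁ then c else 0 := by
          intro k₁
          split_ifs
          · simp only [← add_assoc]
            exact hg.expect_add_le _
          · simp
        have h4 := Finset.expect_le_expect (s := univ) fun k₁ _ => h3 k₁
        rw [expect_ite_eq_add] at h4
        simp only [Finset.expect_const (univ_nonempty (α := Bits n))]
        refine (add_le_add h4 le_rfl).trans (le_of_eq ?_)
        ring
    _ = _ := by ring

lemma card_compl_freeOutputs_le {α : Type*} [DecidableEq α] [Fintype α] (U : List (α × α)) :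
    ((freeOutputs U)ᶜ.card : ℝ) ≤ U.length := by
  have := card_le_card_freeOutputs_add U
  have h2 := card_compl (freeOutputs U)
  exact_mod_cast (by omega : (freeOutputs U)ᶜ.card ≤ U.length)

lemma expect_reprogramFiber_defect_eq {U : List (Bits n × Bits n)} (hU : IsPartialInj U)
    {g : Bits n → ℝ} {c : ℝ} (hg : IsDefect g c) (F₀ : Perm (Bits n)) {x : Bits n}
    (hx : x ∈ freeInputs U) :
    𝔼 F ∈ reprogramFiber U F₀, g (F x + reprogram U F₀ x) =
      (2 ^ n : ℝ)⁻¹ * ∑ v ∈ (freeOutputs U)ᶜ, g (v + reprogram U F₀ x) := by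
  rw [expect_reprogramFiber_apply_of_mem_freeInputs hU F₀ hx fun v => g (v + reprogram U F₀ x)]
  · simp
  · simp [ZModModule.add_self, hg.zero]

/-- For fixed keys and a fixed reprogrammed permutation, the average over the original permutation:
its value at a constrained point is random. -/
lemma expect_reprogramFiber_defect_le {U : List (Bits n × Bits n)} (hU : IsPartialInj U)
    {g : Bits n → ℝ} {c : ℝ} (hg : IsDefect g c) (F₀ : Perm (Bits n)) (x : Bits n) :
    𝔼 F ∈ reprogramFiber U F₀, g (F x + reprogram U F₀ x) ≤ c := by
  have hmean : 𝔼 v, g (v + reprogram U F₀ x) ≤ c := by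
    simpa only [add_comm] using hg.expect_add_le (reprogram U F₀ x)
  by_cases hx : x ∈ freeInputs U
  · rw [expect_reprogramFiber_defect_eq hU hg F₀ hx]
    refine le_trans ?_ hmean
    rw [Fintype.expect_eq_sum_div_card, div_eq_inv_mul]
    have hcard : (Fintype.card (Bits n) : ℝ) = 2 ^ n := by simp
    rw [hcard]
    gcongr
    · exact fun v _ _ => hg.nonneg _
    · exact subset_univ _
  · simp only [mem_freeInputs, not_forall, not_not] at hx
    obtain ⟨p, hp, rfl⟩ := hx
    rw [expect_reprogramFiber_apply hU F₀ hp fun v => g (v + reprogram U F₀ p.1)]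
    exact hmean

/-- For random outer keys and a fixed `F₀`, the average over the permutations with the same
reprogramming as `F₀`. The bound agrees with that of `expect_reprogram_defect_le`, where the
permutation is fixed and its reprogramming varies. -/
lemma expect_expect_reprogramFiber_defect_le {T : List (Bits n × Bits n)} (hT : IsPartialInj T)
    (k₀ : Bits m) {g : Bits n → ℝ} {c : ℝ} (hg : IsDefect g c) (F₀ : Perm (Bits n))
    (x : Bits n) :
    𝔼 k₁, 𝔼 k₂, 𝔼 F ∈ reprogramFiber (unmask (k₀, k₁, k₂) T) F₀,
        g (F x + reprogram (unmask (k₀, k₁, k₂) T) F₀ x) ≤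
      3 * T.length / 2 ^ n * c := by
  have hc := hg.const_nonneg
  set h : Bits n × Bits n → Bits n → Bits n → ℝ := fun p k₁ _ =>
    (if x = p.1 + k₁ then c else 0) + 2 * c / 2 ^ n with hh
  have h0 : ∀ p k₁ k₂, 0 ≤ h p k₁ k₂ := by
    intro p k₁ k₂
    have : 0 ≤ 2 * c / 2 ^ n := by positivity
    simp only [hh]
    split_ifs <;> linarith
  have h1 : ∀ k₁ k₂, 𝔼 F ∈ reprogramFiber (unmask (k₀, k₁, k₂) T) F₀,
        g (F x + reprogram (unmask (k₀, k₁, k₂) T) F₀ x) ≤ (T.map fun p => h p k₁ k₂).sum := by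
    intro k₁ k₂
    have hU := isPartialInj_unmask hT (k₀, k₁, k₂)
    by_cases hx : x ∈ freeInputs (unmask (k₀, k₁, k₂) T)
    · rw [expect_reprogramFiber_defect_eq hU hg F₀ hx]
      have h2 : ∑ v ∈ (freeOutputs (unmask (k₀, k₁, k₂) T))ᶜ,
          g (v + reprogram (unmask (k₀, k₁, k₂) T) F₀ x) ≤ T.length * (2 * c) := by
        refine (Finset.sum_le_card_nsmul _ _ (2 * c) fun v _ => hg.le _).trans ?_
        rw [nsmul_eq_mul]
        gcongr
        simpa [unmask] using card_compl_freeOutputs_le (unmask (k₀, k₁, k₂) T)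
      calc _ ≤ (2 ^ n : ℝ)⁻¹ * (T.length * (2 * c)) := by gcongr
        _ = (T.map fun _ => 2 * c / 2 ^ n).sum := by simp; ring
        _ ≤ _ := by
          refine List.sum_le_sum fun p _ => ?_
          simp only [hh]
          split_ifs <;> linarith
    · refine (expect_reprogramFiber_defect_le hU hg F₀ x).trans ?_
      simp only [mem_freeInputs, not_forall, not_not, unmask, List.mem_map] at hx
      obtain ⟨_, ⟨p, hp, rfl⟩, hpx⟩ := hx
      have h3 : h p k₁ k₂ ≤ (T.map fun p => h p k₁ k₂).sum := by
        refine List.single_le_sum ?_ _ (List.mem_map_of_mem hp)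
        simp only [List.mem_map, forall_exists_index, and_imp, forall_apply_eq_imp_iff₂]
        exact fun p _ => h0 p k₁ k₂
      refine le_trans ?_ h3
      have : 0 ≤ 2 * c / 2 ^ n := by positivity
      simp only [hh, if_pos hpx.symm]
      linarith
  calc _ ≤ 𝔼 k₁, 𝔼 k₂, (T.map fun p => h p k₁ k₂).sum :=
        Finset.expect_le_expect fun _ _ => Finset.expect_le_expect fun _ _ => h1 _ _
    _ ≤ T.length * (3 * c / 2 ^ n) := by
        refine expect_expect_listSum_le T h fun p _ => le_of_eq ?_
        simp only [hh, Finset.expect_add_distrib,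
          Finset.expect_const (univ_nonempty (α := Bits n)), expect_ite_eq_add]
        ring
    _ = _ := by ring

/-- Two ways to draw a pair of points in the same fibre of `f`. -/
lemma expect_expect_fiber_comm {ι κ : Type*} [Fintype ι] [DecidableEq κ] (f : ι → κ)
    (h : ι → ι → ℝ) :
    𝔼 i, 𝔼 j with f j = f i, h i j = 𝔼 j, 𝔼 i with f i = f j, h i j := by
  simp only [Finset.expect_eq_sum_div_card, Finset.sum_filter, Finset.sum_div]
  rw [Finset.sum_comm]
  refine Finset.sum_congr rfl fun j _ => Finset.sum_congr rfl fun i _ => ?_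
  by_cases hij : f i = f j
  · simp [hij]
  · simp [hij, Ne.symm hij]

/-- The block ciphers with the same reprogramming as `E₀` differ from it only at the key `k₀`. -/
lemma expect_cipherFiber (T : List (Bits n × Bits n)) (K : FXKey m n) (E₀ : BlockCipher m n)
    (G : Perm (Bits n) → ℝ) :
    𝔼 E with reprogramCipher T K E = reprogramCipher T K E₀, G (E K.1) =
      𝔼 F ∈ reprogramFiber (unmask K T) (E₀ K.1), G F := by
  refine Finset.expect_nbij' (fun E => E K.1) (fun F => Function.update E₀ K.1 F) ?_ ?_ ?_ ?_ ?_
  · intro E hE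
    rw [mem_filter] at hE
    have := congrFun hE.2 K.1
    rwa [reprogramCipher_self, reprogramCipher_self, ← mem_reprogramFiber] at this
  · intro F hF
    rw [mem_reprogramFiber] at hF
    simp only [mem_filter, mem_univ, true_and]
    simp [reprogramCipher, hF]
  · intro E hE
    rw [mem_filter] at hE
    ext1 k
    by_cases hk : k = K.1
    · subst hk; simp
    · have := congrFun hE.2 k
      rw [reprogramCipher_of_ne _ hk, reprogramCipher_of_ne _ hk] at this
      simp [hk, this]
  · intro F _
    simp
  · intro E _
    rfl

end Averages

/-! ### The quantum query -/

section QuantumStep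

open Finset Equiv
open scoped BigOperators

variable {m n : ℕ} {W : Type*} [Fintype W]

/-- The states after a forward quantum query. -/
noncomputable def queryFwd (ψ : BlockCipher m n → QState m n W) :
    BlockCipher m n → QState m n W :=
  fun E => quantumOracle (fun k x => E k x) (ψ E)

/-- The states after an inverse quantum query. -/
noncomputable def queryInv (ψ : BlockCipher m n → QState m n W) :
    BlockCipher m n → QState m n W :=
  fun E => quantumOracle (fun k x => (E k).symm x) (ψ E)

lemma queryInv_eq (ψ : BlockCipher m n → QState m n W) :
    queryInv ψ = dualFamily (queryFwd (dualFamily ψ)) := by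
  ext1 E
  simp only [queryInv, dualFamily, queryFwd, inv_inv]
  rfl

lemma weight_queryFwd (ψ : BlockCipher m n → QState m n W) : weight (queryFwd ψ) = weight ψ := by
  simp [weight, queryFwd]

lemma weight_queryInv (ψ : BlockCipher m n → QState m n W) : weight (queryInv ψ) = weight ψ := by
  rw [queryInv_eq, weight_dualFamily, weight_queryFwd, weight_dualFamily]

lemma realWeight_queryFwd (T : List (Bits n × Bits n)) (ψ : BlockCipher m n → QState m n W) :
    realWeight T (queryFwd ψ) = realWeight T ψ := by
  simp [realWeight, queryFwd]

lemma realWeight_queryInv (T : List (Bits n × Bits n)) (ψ : BlockCipher m n → QState m n W) :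
    realWeight T (queryInv ψ) = realWeight T ψ := by
  simp [realWeight, queryInv]

lemma sum_shiftDefect_eq (ψ : QState m n W) (k₀ : Bits m) {E E' : BlockCipher m n}
    (h : ∀ k, k ≠ k₀ → E' k = E k) :
    ∑ k, ∑ x, shiftDefect ψ k x (E k x + E' k x) =
      ∑ x, shiftDefect ψ k₀ x (E k₀ x + E' k₀ x) := by
  refine Finset.sum_eq_single_of_mem k₀ (mem_univ _) fun k _ hk => ?_
  refine Finset.sum_eq_zero fun x _ => ?_
  rw [h k hk, ZModModule.add_self]
  exact (isDefect_shiftDefect ψ k x).zero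

/-- A quantum query increases the dependence of the state on the block cipher only through the part
of the state that queries the two exchanged points. -/
lemma spread_queryFwd_le (ψ : BlockCipher m n → QState m n W) :
    spread (queryFwd ψ) ≤ spread ψ + 4 / 2 ^ (m + n) * weight ψ := by
  set A : Bits m → Bits n → Bits n → BlockCipher m n → ℝ := fun k a b E =>
    ∑ x, shiftDefect (ψ E) k x (E k x + (E * swapAt k a b) k x) with hA
  have hne : ∀ (k : Bits m) (a b : Bits n) (E : BlockCipher m n) (l : Bits m), l ≠ k →
      (E * swapAt k a b) l = E l := by
    intro k a b E l hl
    simp [swapAt, hl]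
  have h1 : ∀ k a b E, ‖queryFwd ψ E - queryFwd ψ (E * swapAt k a b)‖ ^ 2 ≤
      ‖ψ E - ψ (E * swapAt k a b)‖ ^ 2 + (A k a b E + A k a b (E * swapAt k a b)) := by
    intro k a b E
    have hA2 : A k a b (E * swapAt k a b) =
        ∑ l, ∑ x, shiftDefect (ψ (E * swapAt k a b)) l x (E l x + (E * swapAt k a b) l x) := by
      rw [sum_shiftDefect_eq _ k (hne k a b E)]
      simp only [hA, mul_assoc, swapAt_mul_self, mul_one, add_comm]
    have hA1 : A k a b E =
        ∑ l, ∑ x, shiftDefect (ψ E) l x (E l x + (E * swapAt k a b) l x) := by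
      rw [sum_shiftDefect_eq _ k (hne k a b E)]
    rw [hA1, hA2, queryFwd, queryFwd, norm_quantumOracle_sub_sq]
    simp only [← Finset.sum_add_distrib]
    gcongr with l _ x _
    simpa using shiftForm_le (ψ E) (ψ (E * swapAt k a b)) l x _ one_pos
  have h2 : ∀ k, 𝔼 a, 𝔼 b, 𝔼 E, A k a b E ≤
      𝔼 E, 2 / 2 ^ n * ∑ x, blockNormSq (ψ E) k x := by
    intro k
    calc 𝔼 a, 𝔼 b, 𝔼 E, A k a b E = 𝔼 E, 𝔼 a, 𝔼 b, A k a b E := by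
          conv_lhs => enter [2, a]; rw [Finset.expect_comm]
          rw [Finset.expect_comm]
      _ ≤ _ := by
          refine Finset.expect_le_expect fun E _ => ?_
          have := expect_swap_defect_le (fun x => isDefect_shiftDefect (ψ E) k x) (E k)
          simpa [hA, swapAt] using this
  have h3 : 𝔼 k, 𝔼 a, 𝔼 b, 𝔼 E, A k a b E ≤ 2 / 2 ^ (m + n) * weight ψ := by
    calc _ ≤ 𝔼 k, 𝔼 E, 2 / 2 ^ n * ∑ x, blockNormSq (ψ E) k x :=
          Finset.expect_le_expect fun k _ => h2 k
      _ = _ := by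
          rw [Finset.expect_comm]
          simp only [← Finset.mul_expect, expect_sum_blockNormSq, weight, ← Finset.expect_div]
          rw [pow_add]
          field_simp
  calc spread (queryFwd ψ)
      ≤ 𝔼 k, 𝔼 a, 𝔼 b, 𝔼 E, (‖ψ E - ψ (E * swapAt k a b)‖ ^ 2 +
          (A k a b E + A k a b (E * swapAt k a b))) :=
        Finset.expect_le_expect fun k _ => Finset.expect_le_expect fun a _ =>
          Finset.expect_le_expect fun b _ => Finset.expect_le_expect fun E _ => h1 k a b E
    _ = spread ψ + (𝔼 k, 𝔼 a, 𝔼 b, 𝔼 E, A k a b E + 𝔼 k, 𝔼 a, 𝔼 b, 𝔼 E, A k a b E) := by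
        have hmr : ∀ k a b, 𝔼 E, A k a b (E * swapAt k a b) = 𝔼 E, A k a b E :=
          fun k a b => expect_mul_right_eq (A k a b) _
        simp only [Finset.expect_add_distrib, spread, hmr]
    _ ≤ spread ψ + (2 / 2 ^ (m + n) * weight ψ + 2 / 2 ^ (m + n) * weight ψ) := by gcongr
    _ = _ := by ring

lemma spread_queryInv_le (ψ : BlockCipher m n → QState m n W) :
    spread (queryInv ψ) ≤ spread ψ + 4 / 2 ^ (m + n) * weight ψ := by
  have := spread_queryFwd_le (dualFamily ψ)
  rwa [weight_dualFamily, spread_dualFamily, ← spread_dualFamily (queryFwd _),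
    ← queryInv_eq] at this

lemma expect_key (f : FXKey m n → ℝ) : 𝔼 K, f K = 𝔼 k₀, 𝔼 k₁, 𝔼 k₂, f (k₀, k₁, k₂) := by
  rw [← Finset.univ_product_univ, Finset.expect_product]
  refine Finset.expect_congr rfl fun k₀ _ => ?_
  rw [← Finset.univ_product_univ, Finset.expect_product]

lemma expect_key_sum_le {c : Bits m → Bits n → ℝ} {g : FXKey m n → Bits n → ℝ} {B : ℝ}
    (h : ∀ k₀ x, 𝔼 k₁, 𝔼 k₂, g (k₀, k₁, k₂) x ≤ B * c k₀ x) :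
    𝔼 K, ∑ x, g K x ≤ B * 𝔼 k₀, ∑ x, c k₀ x := by
  rw [expect_key, Finset.mul_expect]
  refine Finset.expect_le_expect fun k₀ _ => ?_
  calc _ = ∑ x, 𝔼 k₁, 𝔼 k₂, g (k₀, k₁, k₂) x := by
        simp only [Finset.expect_sum_comm]
    _ ≤ _ := by
        rw [Finset.mul_sum]
        exact Finset.sum_le_sum fun x _ => h k₀ x

/-- The increase of the deviation by a quantum query. The state of the real run after the query is
compared with the state of the ideal run for another block cipher `E₁` with the same reprogramming:
given the reprogrammed cipher, on which the real run depends, the original values at the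
reprogrammed points are random. -/
lemma deviation_queryFwd_le {T : List (Bits n × Bits n)} (hT : IsPartialInj T)
    (ψ : BlockCipher m n → QState m n W) {κ : ℝ} (hκ : 0 < κ) :
    deviation T (queryFwd ψ) ≤ (1 + κ) * deviation T ψ +
      (2 + κ⁻¹) * (3 * T.length / 2 ^ (m + n)) * weight ψ := by
  set fib : FXKey m n → BlockCipher m n → Finset (BlockCipher m n) := fun K E =>
    {E₁ | reprogramCipher T K E₁ = reprogramCipher T K E} with hfib
  have hfne : ∀ K E, (fib K E).Nonempty := fun K E => ⟨E, by simp [hfib]⟩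
  -- the defect of `χ` at the shifts by which `E` and the reprogrammed cipher `E'` differ
  set δ : FXKey m n → BlockCipher m n → BlockCipher m n → QState m n W → ℝ := fun K E E' χ =>
    ∑ x, shiftDefect χ K.1 x (E K.1 x + E' K.1 x) with hδ
  have h1 : ∀ E K, ∀ E₁ : BlockCipher m n,
      ‖queryFwd ψ E - queryFwd ψ (reprogramCipher T K E)‖ ^ 2 ≤
        ‖ψ E - ψ (reprogramCipher T K E)‖ ^ 2 +
          (1 + κ⁻¹) * δ K E (reprogramCipher T K E) (ψ E) +
          (δ K E (reprogramCipher T K E) (ψ E₁) +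
            κ * δ K E (reprogramCipher T K E) (ψ (reprogramCipher T K E) - ψ E₁)) := by
    intro E K E₁
    have h := fun χ : QState m n W => sum_shiftDefect_eq χ K.1 (E := E)
      (E' := reprogramCipher T K E) fun k hk => reprogramCipher_of_ne T hk E
    simp only [hδ, ← h]
    rw [queryFwd, queryFwd, norm_quantumOracle_sub_sq, add_assoc]
    simp only [Finset.mul_sum, ← Finset.sum_add_distrib]
    gcongr with l _ x _
    exact shiftForm_le_add_sub _ _ _ _ _ _ hκ
  have h2 : 𝔼 E, 𝔼 K, δ K E (reprogramCipher T K E) (ψ E) ≤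
      3 * T.length / 2 ^ (m + n) * weight ψ := by
    calc _ ≤ 𝔼 E, 3 * T.length / 2 ^ n * 𝔼 k, ∑ x, blockNormSq (ψ E) k x := by
          refine Finset.expect_le_expect fun E _ => ?_
          refine expect_key_sum_le (c := blockNormSq (ψ E)) (g := fun K x =>
            shiftDefect (ψ E) K.1 x (E K.1 x + reprogramCipher T K E K.1 x)) fun k₀ x => ?_
          have hself : ∀ k₁ k₂, reprogramCipher T (k₀, k₁, k₂) E k₀ =
              reprogram (unmask (k₀, k₁, k₂) T) (E k₀) :=
            fun k₁ k₂ => reprogramCipher_self T (k₀, k₁, k₂) E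
          simp only [hself]
          exact expect_reprogram_defect_le hT k₀ (isDefect_shiftDefect (ψ E) k₀ x) (E k₀) x
      _ = _ := by
          simp only [← Finset.mul_expect, expect_sum_blockNormSq, weight, ← Finset.expect_div]
          rw [pow_add]
          field_simp
  have hfibre : ∀ (χ : QState m n W) (K : FXKey m n) (E₁ : BlockCipher m n),
      𝔼 E ∈ fib K E₁, δ K E (reprogramCipher T K E₁) χ =
        ∑ x, 𝔼 F ∈ reprogramFiber (unmask K T) (E₁ K.1),
          shiftDefect χ K.1 x (F x + reprogram (unmask K T) (E₁ K.1) x) := by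
    intro χ K E₁
    rw [← Finset.expect_sum_comm, ← expect_cipherFiber]
    simp only [hδ, reprogramCipher_self]
    rfl
  have h3 : 𝔼 E₁, 𝔼 K, 𝔼 E ∈ fib K E₁, δ K E (reprogramCipher T K E₁) (ψ E₁) ≤
      3 * T.length / 2 ^ (m + n) * weight ψ := by
    calc _ ≤ 𝔼 E₁, 3 * T.length / 2 ^ n * 𝔼 k, ∑ x, blockNormSq (ψ E₁) k x := by
          refine Finset.expect_le_expect fun E₁ _ => ?_
          simp only [hfibre]
          refine expect_key_sum_le (c := blockNormSq (ψ E₁)) (g := fun K x =>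
            𝔼 F ∈ reprogramFiber (unmask K T) (E₁ K.1),
              shiftDefect (ψ E₁) K.1 x (F x + reprogram (unmask K T) (E₁ K.1) x)) fun k₀ x => ?_
          exact expect_expect_reprogramFiber_defect_le hT k₀
            (isDefect_shiftDefect (ψ E₁) k₀ x) (E₁ k₀) x
      _ = _ := by
          simp only [← Finset.mul_expect, expect_sum_blockNormSq, weight, ← Finset.expect_div]
          rw [pow_add]
          field_simp
  have h4 : 𝔼 E₁, 𝔼 K, 𝔼 E ∈ fib K E₁, δ K E (reprogramCipher T K E₁)
      (ψ (reprogramCipher T K E₁) - ψ E₁) ≤ deviation T ψ := by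
    refine Finset.expect_le_expect fun E₁ _ => Finset.expect_le_expect fun K _ => ?_
    rw [hfibre, norm_sub_rev]
    refine le_trans (Finset.sum_le_sum fun x _ => ?_) (sum_blockNormSq_le _ K.1)
    exact expect_reprogramFiber_defect_le (isPartialInj_unmask hT K) (isDefect_shiftDefect _ _ _)
      _ _
  have hswap : ∀ h : FXKey m n → BlockCipher m n → BlockCipher m n → ℝ,
      𝔼 E, 𝔼 K, 𝔼 E₁ ∈ fib K E, h K E E₁ = 𝔼 E₁, 𝔼 K, 𝔼 E ∈ fib K E₁, h K E E₁ := by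
    intro h
    rw [Finset.expect_comm]
    conv_rhs => rw [Finset.expect_comm]
    exact Finset.expect_congr rfl fun K _ => expect_expect_fiber_comm (reprogramCipher T K) (h K)
  have h5 : deviation T (queryFwd ψ) ≤ 𝔼 E, 𝔼 K, 𝔼 E₁ ∈ fib K E,
      (‖ψ E - ψ (reprogramCipher T K E)‖ ^ 2 +
          (1 + κ⁻¹) * δ K E (reprogramCipher T K E) (ψ E) +
          (δ K E (reprogramCipher T K E₁) (ψ E₁) +
            κ * δ K E (reprogramCipher T K E₁) (ψ (reprogramCipher T K E₁) - ψ E₁))) := by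
    refine Finset.expect_le_expect fun E _ => Finset.expect_le_expect fun K _ => ?_
    rw [← Finset.expect_const (hfne K E) (‖queryFwd ψ E - queryFwd ψ (reprogramCipher T K E)‖ ^ 2)]
    refine Finset.expect_le_expect fun E₁ hE₁ => ?_
    have : reprogramCipher T K E₁ = reprogramCipher T K E := by simpa [hfib] using hE₁
    rw [this]
    exact h1 E K E₁
  refine h5.trans ?_
  simp only [Finset.expect_add_distrib, Finset.expect_const (hfne _ _), ← Finset.mul_expect,
    hswap fun K E E₁ => δ K E (reprogramCipher T K E₁) (ψ E₁),
    hswap fun K E E₁ =>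
      δ K E (reprogramCipher T K E₁) (ψ (reprogramCipher T K E₁) - ψ E₁)]
  have h6 : 𝔼 E, 𝔼 K, ‖ψ E - ψ (reprogramCipher T K E)‖ ^ 2 = deviation T ψ := rfl
  rw [h6]
  have h7 : (1 + κ⁻¹) * 𝔼 E, 𝔼 K, δ K E (reprogramCipher T K E) (ψ E) ≤
      (1 + κ⁻¹) * (3 * T.length / 2 ^ (m + n) * weight ψ) := by gcongr
  have h8 := mul_le_mul_of_nonneg_left h4 hκ.le
  linarith

lemma deviation_queryInv_le {T : List (Bits n × Bits n)} (hT : IsPartialInj T)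
    (ψ : BlockCipher m n → QState m n W) {κ : ℝ} (hκ : 0 < κ) :
    deviation T (queryInv ψ) ≤ (1 + κ) * deviation T ψ +
      (2 + κ⁻¹) * (3 * T.length / 2 ^ (m + n)) * weight ψ := by
  have := deviation_queryFwd_le hT.map_swap (dualFamily ψ) hκ
  rwa [deviation_dualFamily, weight_dualFamily, List.length_map, ← deviation_dualFamily,
    List.map_map, Prod.swap_swap_eq, List.map_id, ← queryInv_eq] at this

end QuantumStep

/-! ### The hybrid argument -/

section Hybrid

open Finset Equiv
open scoped BigOperators

variable {m n : ℕ} {W : Type*} [Fintype W]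

/-- The acceptance probability of the rest of the run when, after the transcript `T` and with the
states `ψ`, the run is continued as in the real world with the reprogrammed block cipher. -/
noncomputable def realNow (alg : QAlgorithm m n W) (T : List (Bits n × Bits n))
    (ψ : BlockCipher m n → QState m n W) : ℝ :=
  𝔼 E, 𝔼 K : FXKey m n, alg.acceptProb
    (fxCipher (reprogramCipher T K E) K.1 K.2.1 K.2.2) (reprogramCipher T K E)
    (ψ (reprogramCipher T K E))

/-- The acceptance probability of the rest of the ideal run, after the transcript `T` and with the
states `ψ`. -/
noncomputable def idealNow (alg : QAlgorithm m n W) (T : List (Bits n × Bits n))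
    (ψ : BlockCipher m n → QState m n W) : ℝ :=
  𝔼 E, 𝔼 R : Perm (Bits n), alg.acceptProb (reprogram T R) E (ψ E)

/-- Twice the difference of the acceptance probabilities, minus the difference of the total
probabilities; in other words, the difference of the probabilities of output `1`, minus that of the
probabilities of output `0`. -/
noncomputable def discrepancy (alg : QAlgorithm m n W) (T : List (Bits n × Bits n))
    (ψ : BlockCipher m n → QState m n W) : ℝ :=
  2 * (realNow alg T ψ - idealNow alg T ψ) - (realWeight T ψ - weight ψ)

/-- The bound on the discrepancy of an algorithm with at most `c` classical and `q` quantum queries.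
The root mean square distance of the states of the two runs is thought of as bounded by a number
that starts from a positive value, grows with every query and never exceeds `A`; `D` is its current
value. Dividing the deviation by `D` makes the bound additive over the branches of the
algorithm. -/
noncomputable def hybridBound (A μ β ν : ℝ) (c q : ℕ) (D : ℝ) (T : List (Bits n × Bits n))
    (ψ : BlockCipher m n → QState m n W) : ℝ :=
  A / (2 * μ) * (deviation T ψ / D + q * β * weight ψ +
    c * ν * (spread ψ + q * (4 / 2 ^ (m + n)) * weight ψ)) + μ * (realWeight T ψ + weight ψ)

lemma hybridBound_mono {A μ β ν D : ℝ} (hA : 0 ≤ A) (hμ : 0 < μ) (hβ : 0 ≤ β) (hν : 0 ≤ ν)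
    {c c' q q' : ℕ} (hc : c ≤ c') (hq : q ≤ q') (T : List (Bits n × Bits n))
    (ψ : BlockCipher m n → QState m n W) :
    hybridBound A μ β ν c q D T ψ ≤ hybridBound A μ β ν c' q' D T ψ := by
  have := weight_nonneg ψ
  have := spread_nonneg ψ
  unfold hybridBound
  gcongr

/-- At the end of the run the discrepancy is bounded by the distance of the states. -/
lemma abs_discrepancy_output_le {A μ β ν D : ℝ} (hμ : 0 < μ) (hβ : 0 ≤ β) (hν : 0 ≤ ν)
    (hD : 0 < D) (hDA : D ≤ A) (c q : ℕ) (b : Bool) (T : List (Bits n × Bits n))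
    (ψ : BlockCipher m n → QState m n W) :
    |discrepancy (.output b) T ψ| ≤ hybridBound A μ β ν c q D T ψ := by
  have hd : discrepancy (.output b) T ψ = (if b then 1 else -1) * (realWeight T ψ - weight ψ) := by
    cases b
    · simp [discrepancy, realNow, idealNow, QAlgorithm.acceptProb]
    · have h1 : realNow (.output true) T ψ = realWeight T ψ := by
        simp [realNow, QAlgorithm.acceptProb, realWeight]
      have h2 : idealNow (.output true) T ψ = weight ψ := by
        simp [idealNow, QAlgorithm.acceptProb, weight]
      simp only [discrepancy, h1, h2, if_true]
      ring
  have hd' : |discrepancy (.output b) T ψ| = |realWeight T ψ - weight ψ| := by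
    rw [hd, abs_mul]
    cases b <;> simp
  have hpt : ∀ a b : QState m n W,
      |‖b‖ ^ 2 - ‖a‖ ^ 2| ≤ ‖a - b‖ ^ 2 / (2 * μ) + μ * (‖b‖ ^ 2 + ‖a‖ ^ 2) := by
    intro a b
    have h1 : |‖b‖ ^ 2 - ‖a‖ ^ 2| ≤ ‖a - b‖ * (‖b‖ + ‖a‖) := by
      rw [sq_sub_sq, abs_mul, abs_of_nonneg (by positivity : 0 ≤ ‖b‖ + ‖a‖), mul_comm]
      gcongr
      rw [norm_sub_rev]
      exact abs_norm_sub_norm_le b a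
    have h2 : 0 ≤ (‖a - b‖ - μ * (‖b‖ + ‖a‖)) ^ 2 / (2 * μ) := by positivity
    have h3 : (‖a - b‖ - μ * (‖b‖ + ‖a‖)) ^ 2 / (2 * μ) =
        ‖a - b‖ ^ 2 / (2 * μ) - ‖a - b‖ * (‖b‖ + ‖a‖) + μ * ((‖b‖ + ‖a‖) ^ 2 / 2) := by
      field_simp; ring
    have h4 : μ * ((‖b‖ + ‖a‖) ^ 2 / 2) ≤ μ * (‖b‖ ^ 2 + ‖a‖ ^ 2) := by
      gcongr
      nlinarith [sq_nonneg (‖b‖ - ‖a‖)]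
    linarith
  have hw : weight ψ = 𝔼 E, 𝔼 _K : FXKey m n, ‖ψ E‖ ^ 2 := by simp [weight]
  have hmain : |realWeight T ψ - weight ψ| ≤
      deviation T ψ / (2 * μ) + μ * (realWeight T ψ + weight ψ) := by
    have h := fun (E : BlockCipher m n) (K : FXKey m n) =>
      abs_le.1 (hpt (ψ E) (ψ (reprogramCipher T K E)))
    rw [hw]
    simp only [realWeight, deviation, Finset.expect_div, ← Finset.expect_add_distrib,
      Finset.mul_expect, ← Finset.expect_sub_distrib]
    rw [abs_le, ← Finset.expect_neg_distrib]
    simp only [← Finset.expect_neg_distrib]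
    exact ⟨Finset.expect_le_expect fun E _ => Finset.expect_le_expect fun K _ => (h E K).1,
      Finset.expect_le_expect fun E _ => Finset.expect_le_expect fun K _ => (h E K).2⟩
  rw [hd']
  refine hmain.trans ?_
  have hdev := deviation_nonneg T ψ
  have hwn := weight_nonneg ψ
  have hsn := spread_nonneg ψ
  unfold hybridBound
  gcongr ?_ + _
  have hA : 0 ≤ A := hD.le.trans hDA
  have h1 : deviation T ψ ≤ A * (deviation T ψ / D) := by
    rw [mul_div_assoc', le_div_iff₀ hD, mul_comm]
    gcongr
  calc deviation T ψ / (2 * μ) ≤ A * (deviation T ψ / D) / (2 * μ) := by gcongr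
    _ = A / (2 * μ) * (deviation T ψ / D + 0) := by ring
    _ ≤ A / (2 * μ) * (deviation T ψ / D + (q * β * weight ψ +
      c * ν * (spread ψ + q * (4 / 2 ^ (m + n)) * weight ψ))) := by
      gcongr
      positivity
    _ = _ := by ring

/-- A quantum query costs `β` in the growth of `D`, by the choice `κ = β / D`. The number `j` is the
length of the transcript. -/
lemma hybridBound_query_le {A μ β ν D : ℝ} (hA : 0 ≤ A) (hμ : 0 < μ) (hβ : 0 < β) (hν : 0 ≤ ν)
    (hβD : 2 * β ≤ D) {j : ℕ} (hj : 4 * (j : ℝ) / 2 ^ (m + n) ≤ β ^ 2) (c q : ℕ)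
    {T : List (Bits n × Bits n)} {ψ ψ' : BlockCipher m n → QState m n W}
    (hdev : ∀ κ : ℝ, 0 < κ → deviation T ψ' ≤ (1 + κ) * deviation T ψ +
      (2 + κ⁻¹) * (3 * j / 2 ^ (m + n)) * weight ψ)
    (hw : weight ψ' = weight ψ) (hr : realWeight T ψ' = realWeight T ψ)
    (hs : spread ψ' ≤ spread ψ + 4 / 2 ^ (m + n) * weight ψ) :
    hybridBound A μ β ν c q (D + β) T ψ' ≤ hybridBound A μ β ν c (q + 1) D T ψ := by
  have hD : 0 < D := by linarith
  have hwn := weight_nonneg ψ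
  have hdn := deviation_nonneg T ψ
  have h1 : deviation T ψ' / (D + β) ≤ deviation T ψ / D + β * weight ψ := by
    have h := hdev (β / D) (by positivity)
    have h2 : (3 * j / 2 ^ (m + n) : ℝ) ≤ 3 / 4 * β ^ 2 := by
      calc (3 * j / 2 ^ (m + n) : ℝ) = 3 / 4 * (4 * j / 2 ^ (m + n)) := by ring
        _ ≤ _ := by gcongr
    have h3 : (2 + (β / D)⁻¹) * (3 * j / 2 ^ (m + n)) ≤ β * (D + β) := by
      calc _ ≤ (2 + (β / D)⁻¹) * (3 / 4 * β ^ 2) := by gcongr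
        _ = 3 / 4 * (2 * β ^ 2 + β * D) := by field_simp
        _ ≤ _ := by nlinarith
    rw [div_le_iff₀ (by positivity)]
    calc deviation T ψ' ≤ (1 + β / D) * deviation T ψ + β * (D + β) * weight ψ := by
          refine h.trans ?_
          gcongr
      _ = _ := by field_simp
  unfold hybridBound
  rw [hw, hr]
  gcongr ?_ + _
  refine mul_le_mul_of_nonneg_left ?_ (by positivity)
  have h4 : c * ν * (spread ψ' + q * (4 / 2 ^ (m + n)) * weight ψ) ≤
      c * ν * (spread ψ + ((q + 1 : ℕ) : ℝ) * (4 / 2 ^ (m + n)) * weight ψ) := by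
    refine mul_le_mul_of_nonneg_left ?_ (by positivity)
    push_cast
    linarith
  push_cast at h4 ⊢
  linarith

/-- A fresh classical query costs `γ` in the growth of `D`; the choice `κ = γ / D` makes the growth
of the deviation, divided by the new value `D + γ`, exactly additive. -/
lemma expect_hybridBound_cons_le {A μ β γ M D : ℝ} (hA : 0 ≤ A) (hμ : 0 < μ)
    (hγ : 0 < γ) (hM : 0 < M) (hD : 0 < D) (c q : ℕ) {T : List (Bits n × Bits n)}
    {ψ : BlockCipher m n → QState m n W} {Z : Finset (Bits n)} (hZ : Z.Nonempty)
    {T' : Bits n → List (Bits n × Bits n)}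
    (hdev : ∀ κ : ℝ, 0 < κ → 𝔼 z ∈ Z, deviation (T' z) ψ ≤ (1 + κ) * deviation T ψ +
      (1 + κ⁻¹) * ((2 : ℝ) ^ n / M * spread ψ))
    (hr : 𝔼 z ∈ Z, realWeight (T' z) ψ = realWeight T ψ) :
    𝔼 z ∈ Z, hybridBound A μ β (2 ^ n / (M * γ)) c q (D + γ) (T' z) ψ ≤
      hybridBound A μ β (2 ^ n / (M * γ)) (c + 1) q D T ψ := by
  have hwn := weight_nonneg ψ
  have hsn := spread_nonneg ψ
  have h1 : (𝔼 z ∈ Z, deviation (T' z) ψ) / (D + γ) ≤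
      deviation T ψ / D + 2 ^ n / (M * γ) * spread ψ := by
    rw [div_le_iff₀ (by positivity)]
    refine (hdev (γ / D) (by positivity)).trans (le_of_eq ?_)
    field_simp
    ring
  have h2 : 𝔼 z ∈ Z, hybridBound A μ β (2 ^ n / (M * γ)) c q (D + γ) (T' z) ψ =
      A / (2 * μ) * ((𝔼 z ∈ Z, deviation (T' z) ψ) / (D + γ) + q * β * weight ψ +
        c * (2 ^ n / (M * γ)) * (spread ψ + q * (4 / 2 ^ (m + n)) * weight ψ)) +
        μ * (realWeight T ψ + weight ψ) := by
    rw [← hr]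
    simp only [hybridBound, Finset.expect_add_distrib, ← Finset.mul_expect,
      Finset.expect_const hZ, ← Finset.expect_div]
  rw [h2]
  unfold hybridBound
  gcongr ?_ + _
  refine mul_le_mul_of_nonneg_left ?_ (by positivity)
  have h3 : 0 ≤ 2 ^ n / (M * γ) * (q * (4 / 2 ^ (m + n)) * weight ψ) := by positivity
  push_cast
  linarith

lemma sum_norm_sq_apply_eq {r : ℕ} {M : Fin r → (QState m n W →L[ℂ] QState m n W)}
    (hM : ∑ i, star (M i) * M i = 1) (v : QState m n W) : ∑ i, ‖M i v‖ ^ 2 = ‖v‖ ^ 2 := by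
  have h : ∀ i, ((‖M i v‖ ^ 2 : ℝ) : ℂ) = inner ℂ v ((star (M i) * M i) v) := by
    intro i
    rw [mul_apply_eq_comp, ContinuousLinearMap.star_eq_adjoint,
      ContinuousLinearMap.adjoint_inner_right, inner_self_eq_norm_sq_to_K]
    simp
  have h2 : ((∑ i, ‖M i v‖ ^ 2 : ℝ) : ℂ) = ((‖v‖ ^ 2 : ℝ) : ℂ) := by
    rw [Complex.ofReal_sum]
    simp only [h]
    rw [← inner_sum, ← _root_.sum_apply, hM, one_apply_eq_self,
      inner_self_eq_norm_sq_to_K]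
    simp
  exact_mod_cast h2

lemma sum_hybridBound_measure {r : ℕ} {M : Fin r → (QState m n W →L[ℂ] QState m n W)}
    (hM : ∑ i, star (M i) * M i = 1) (A μ β ν : ℝ) (c q : ℕ) (D : ℝ)
    (T : List (Bits n × Bits n)) (ψ : BlockCipher m n → QState m n W) :
    ∑ i, hybridBound A μ β ν c q D T (fun E => M i (ψ E)) = hybridBound A μ β ν c q D T ψ := by
  have hw : ∑ i, weight (fun E => M i (ψ E)) = weight ψ := by
    simp only [weight, ← Finset.expect_sum_comm, sum_norm_sq_apply_eq hM]
  have hr : ∑ i, realWeight T (fun E => M i (ψ E)) = realWeight T ψ := by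
    simp only [realWeight, ← Finset.expect_sum_comm, sum_norm_sq_apply_eq hM]
  have hd : ∑ i, deviation T (fun E => M i (ψ E)) = deviation T ψ := by
    simp only [deviation, ← Finset.expect_sum_comm, ← map_sub, sum_norm_sq_apply_eq hM]
  have hs : ∑ i, spread (fun E => M i (ψ E)) = spread ψ := by
    simp only [spread, ← Finset.expect_sum_comm, ← map_sub, sum_norm_sq_apply_eq hM]
  unfold hybridBound
  simp only [Finset.sum_add_distrib, ← Finset.mul_sum, ← Finset.sum_div, hw, hr, hd, hs]

lemma discrepancy_measure {r : ℕ} {M : Fin r → (QState m n W →L[ℂ] QState m n W)}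
    (hM : ∑ i, star (M i) * M i = 1) (next : Fin r → QAlgorithm m n W)
    (T : List (Bits n × Bits n)) (ψ : BlockCipher m n → QState m n W) :
    discrepancy (.measure M hM next) T ψ = ∑ i, discrepancy (next i) T (fun E => M i (ψ E)) := by
  have hw : ∑ i, weight (fun E => M i (ψ E)) = weight ψ := by
    simp only [weight, ← Finset.expect_sum_comm, sum_norm_sq_apply_eq hM]
  have hr : ∑ i, realWeight T (fun E => M i (ψ E)) = realWeight T ψ := by
    simp only [realWeight, ← Finset.expect_sum_comm, sum_norm_sq_apply_eq hM]
  simp only [discrepancy, Finset.sum_sub_distrib, ← Finset.mul_sum, hw, hr]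
  simp only [realNow, idealNow, QAlgorithm.acceptProb, ← Finset.expect_sum_comm]

lemma discrepancy_classicalFwd_of_mem {T : List (Bits n × Bits n)} (hT : IsPartialInj T)
    {p : Bits n × Bits n} (hp : p ∈ T) (next : Bits n → QAlgorithm m n W)
    (ψ : BlockCipher m n → QState m n W) :
    discrepancy (.classicalFwd p.1 next) T ψ = discrepancy (next p.2) T ψ := by
  simp only [discrepancy, realNow, idealNow, QAlgorithm.acceptProb,
    fxCipher_reprogramCipher_apply hT _ _ hp, reprogram_apply hT _ hp]

lemma discrepancy_classicalInv_of_mem {T : List (Bits n × Bits n)} (hT : IsPartialInj T)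
    {p : Bits n × Bits n} (hp : p ∈ T) (next : Bits n → QAlgorithm m n W)
    (ψ : BlockCipher m n → QState m n W) :
    discrepancy (.classicalInv p.2 next) T ψ = discrepancy (next p.1) T ψ := by
  have h1 : ∀ (K : FXKey m n) (E : BlockCipher m n),
      (fxCipher (reprogramCipher T K E) K.1 K.2.1 K.2.2).symm p.2 = p.1 := fun K E => by
    rw [Equiv.symm_apply_eq, fxCipher_reprogramCipher_apply hT _ _ hp]
  have h2 : ∀ R : Perm (Bits n), (reprogram T R).symm p.2 = p.1 := fun R => by
    rw [Equiv.symm_apply_eq, reprogram_apply hT _ hp]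
  simp only [discrepancy, realNow, idealNow, QAlgorithm.acceptProb, h1, h2]

lemma isPartialInj_cons_of_free {T : List (Bits n × Bits n)} (hT : IsPartialInj T) {x y : Bits n}
    (hx : x ∈ freeInputs T) (hy : y ∈ freeOutputs T) : IsPartialInj ((x, y) :: T) := by
  rw [mem_freeInputs] at hx
  rw [mem_freeOutputs] at hy
  exact isPartialInj_cons.2 ⟨fun q hq => ⟨(hx q hq).symm, (hy q hq).symm⟩, hT⟩

/-- A fresh query can be answered by a random fresh value in both worlds. -/
lemma discrepancy_classicalFwd_of_free {T : List (Bits n × Bits n)} (hT : IsPartialInj T)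
    {x : Bits n} (hx : x ∈ freeInputs T) (next : Bits n → QAlgorithm m n W)
    (ψ : BlockCipher m n → QState m n W) :
    discrepancy (.classicalFwd x next) T ψ =
      𝔼 y ∈ freeOutputs T, discrepancy (next y) ((x, y) :: T) ψ := by
  have hne : (freeOutputs T).Nonempty := ⟨_, apply_mem_freeOutputs hT 1 hx⟩
  have h1 : 𝔼 y ∈ freeOutputs T, realNow (next y) ((x, y) :: T) ψ =
      realNow (.classicalFwd x next) T ψ := by
    have key := expect_expect_reprogramCipher_cons hT hx fun (K : FXKey m n) E' =>
      (QAlgorithm.classicalFwd x next).acceptProb (fxCipher E' K.1 K.2.1 K.2.2) E' (ψ E')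
    refine Eq.trans (Finset.expect_congr rfl fun y hy => ?_) key
    simp only [QAlgorithm.acceptProb, fxCipher_reprogramCipher_apply
      (isPartialInj_cons_of_free hT hx hy) _ _ (p := (x, y)) List.mem_cons_self]
    rfl
  have h2 : 𝔼 y ∈ freeOutputs T, idealNow (next y) ((x, y) :: T) ψ =
      idealNow (.classicalFwd x next) T ψ := by
    simp only [idealNow]
    rw [Finset.expect_comm]
    refine Finset.expect_congr rfl fun E _ => ?_
    rw [← expect_expect_reprogram_cons hT hx fun P =>
      (QAlgorithm.classicalFwd x next).acceptProb P E (ψ E)]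
    refine Finset.expect_congr rfl fun y hy => Finset.expect_congr rfl fun R _ => ?_
    rw [QAlgorithm.acceptProb, reprogram_apply (isPartialInj_cons_of_free hT hx hy) _
      (p := (x, y)) List.mem_cons_self]
  have h3 : 𝔼 y ∈ freeOutputs T, realWeight ((x, y) :: T) ψ = realWeight T ψ :=
    expect_expect_reprogramCipher_cons hT hx fun (_ : FXKey m n) E' => ‖ψ E'‖ ^ 2
  simp only [discrepancy, Finset.expect_sub_distrib, ← Finset.mul_expect, h1, h2, h3,
    Finset.expect_const hne]

lemma discrepancy_classicalInv_of_free {T : List (Bits n × Bits n)} (hT : IsPartialInj T)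
    {y : Bits n} (hy : y ∈ freeOutputs T) (next : Bits n → QAlgorithm m n W)
    (ψ : BlockCipher m n → QState m n W) :
    discrepancy (.classicalInv y next) T ψ =
      𝔼 x ∈ freeInputs T, discrepancy (next x) ((x, y) :: T) ψ := by
  have hne : (freeInputs T).Nonempty := ⟨_, inv_apply_mem_freeInputs hT 1 hy⟩
  have h1 : 𝔼 x ∈ freeInputs T, realNow (next x) ((x, y) :: T) ψ =
      realNow (.classicalInv y next) T ψ := by
    have key := expect_expect_reprogramCipher_cons_inv hT hy fun (K : FXKey m n) E' =>
      (QAlgorithm.classicalInv y next).acceptProb (fxCipher E' K.1 K.2.1 K.2.2) E' (ψ E')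
    refine Eq.trans (Finset.expect_congr rfl fun x hx => ?_) key
    have hs : ∀ (K : FXKey m n) (E : BlockCipher m n),
        (fxCipher (reprogramCipher ((x, y) :: T) K E) K.1 K.2.1 K.2.2).symm y = x :=
      fun K E => by
        rw [Equiv.symm_apply_eq]
        exact (fxCipher_reprogramCipher_apply (isPartialInj_cons_of_free hT hx hy) K E
          (p := (x, y)) List.mem_cons_self).symm
    simp only [QAlgorithm.acceptProb, hs]
    rfl
  have h2 : 𝔼 x ∈ freeInputs T, idealNow (next x) ((x, y) :: T) ψ =
      idealNow (.classicalInv y next) T ψ := by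
    simp only [idealNow]
    rw [Finset.expect_comm]
    refine Finset.expect_congr rfl fun E _ => ?_
    rw [← expect_expect_reprogram_cons_inv hT hy fun P =>
      (QAlgorithm.classicalInv y next).acceptProb P E (ψ E)]
    refine Finset.expect_congr rfl fun x hx => Finset.expect_congr rfl fun R _ => ?_
    have hs : (reprogram ((x, y) :: T) R).symm y = x := by
      rw [Equiv.symm_apply_eq]
      exact (reprogram_apply (isPartialInj_cons_of_free hT hx hy) R
        (p := (x, y)) List.mem_cons_self).symm
    rw [QAlgorithm.acceptProb, hs]
  have h3 : 𝔼 x ∈ freeInputs T, realWeight ((x, y) :: T) ψ = realWeight T ψ :=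
    expect_expect_reprogramCipher_cons_inv hT hy fun (_ : FXKey m n) E' => ‖ψ E'‖ ^ 2
  simp only [discrepancy, Finset.expect_sub_distrib, ← Finset.mul_expect, h1, h2, h3,
    Finset.expect_const hne]

lemma discrepancy_quantumFwd (next : QAlgorithm m n W) (T : List (Bits n × Bits n))
    (ψ : BlockCipher m n → QState m n W) :
    discrepancy (.quantumFwd next) T ψ = discrepancy next T (queryFwd ψ) := by
  rw [discrepancy, discrepancy, realWeight_queryFwd, weight_queryFwd]
  rfl

lemma discrepancy_quantumInv (next : QAlgorithm m n W) (T : List (Bits n × Bits n))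
    (ψ : BlockCipher m n → QState m n W) :
    discrepancy (.quantumInv next) T ψ = discrepancy next T (queryInv ψ) := by
  rw [discrepancy, discrepancy, realWeight_queryInv, weight_queryInv]
  rfl

/-- The discrepancy of an algorithm, by induction on the algorithm: every query moves both runs one
step, at a cost that is paid by the growth of `D`. -/
theorem abs_discrepancy_le {A μ β γ M : ℝ} {N : ℕ} (hμ : 0 < μ) (hβ : 0 < β)
    (hγ : 0 < γ) (hM : 0 < M) (hMN : M + N ≤ 2 ^ n + 1)
    (hβN : 4 * (N : ℝ) / 2 ^ (m + n) ≤ β ^ 2) (alg : QAlgorithm m n W) :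
    ∀ (c q : ℕ) (T : List (Bits n × Bits n)) (ψ : BlockCipher m n → QState m n W) (D : ℝ),
      alg.classicalQueries ≤ c → alg.quantumQueries ≤ q → IsPartialInj T → T.length + c ≤ N →
      2 * β ≤ D → D + c * γ + q * β ≤ A →
      |discrepancy alg T ψ| ≤ hybridBound A μ β (2 ^ n / (M * γ)) c q D T ψ := by
  have hν : 0 ≤ 2 ^ n / (M * γ) := by positivity
  have hlen : ∀ {c : ℕ} {T : List (Bits n × Bits n)}, T.length + (c + 1) ≤ N →
      M + T.length ≤ 2 ^ n := by
    intro c T h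
    have : ((T.length + (c + 1) : ℕ) : ℝ) ≤ N := Nat.cast_le.2 h
    push_cast at this
    have : (0 : ℝ) ≤ c := Nat.cast_nonneg c
    linarith
  have hA : ∀ {c q : ℕ} {D : ℝ}, 2 * β ≤ D → D + c * γ + q * β ≤ A → 0 < D ∧ D ≤ A := by
    intro c q D h1 h2
    have : 0 ≤ c * γ + q * β := by positivity
    constructor <;> linarith
  have hβT : ∀ {c : ℕ} {T : List (Bits n × Bits n)}, T.length + c ≤ N →
      4 * (T.length : ℝ) / 2 ^ (m + n) ≤ β ^ 2 := by
    intro c T h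
    refine le_trans ?_ hβN
    gcongr
    omega
  induction alg with
  | output b =>
    intro c q T ψ D _ _ _ _ hβD hDA
    obtain ⟨hD, hDA⟩ := hA hβD hDA
    exact abs_discrepancy_output_le hμ hβ.le hν hD hDA c q b T ψ
  | measure K hK next ih =>
    intro c q T ψ D hc hq hT hcN hβD hDA
    rw [discrepancy_measure, ← sum_hybridBound_measure hK]
    refine (Finset.abs_sum_le_sum_abs _ _).trans (Finset.sum_le_sum fun i _ => ?_)
    refine ih i c q T _ D (le_trans ?_ hc) (le_trans ?_ hq) hT hcN hβD hDA
    · exact Finset.le_sup (f := fun i => (next i).classicalQueries) (mem_univ i)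
    · exact Finset.le_sup (f := fun i => (next i).quantumQueries) (mem_univ i)
  | classicalFwd x next ih =>
    intro c q T ψ D hc hq hT hcN hβD hDA
    obtain ⟨hD, hDA'⟩ := hA hβD hDA
    obtain ⟨c, rfl⟩ : ∃ c', c = c' + 1 :=
      ⟨c - 1, by simp only [QAlgorithm.classicalQueries] at hc; omega⟩
    have hc' : ∀ z, (next z).classicalQueries ≤ c := fun z =>
      (Finset.le_sup (f := fun z => (next z).classicalQueries) (mem_univ z)).trans
        (Nat.le_of_succ_le_succ hc)
    have hq' : ∀ z, (next z).quantumQueries ≤ q := fun z =>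
      (Finset.le_sup (f := fun z => (next z).quantumQueries) (mem_univ z)).trans hq
    push_cast at hDA
    by_cases hx : x ∈ freeInputs T
    · rw [discrepancy_classicalFwd_of_free hT hx]
      refine (Finset.abs_expect_le _ _).trans ?_
      refine le_trans (Finset.expect_le_expect fun y hy => ?_)
        (expect_hybridBound_cons_le (hD.le.trans hDA') hμ hγ hM hD c q
          ⟨_, apply_mem_freeOutputs hT 1 hx⟩ (T' := fun y => (x, y) :: T)
          (fun κ hκ => expect_deviation_cons_le hT hx ψ hM (hlen hcN) hκ)
          (expect_expect_reprogramCipher_cons hT hx fun (_ : FXKey m n) E' => ‖ψ E'‖ ^ 2))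
      refine ih y c q _ ψ (D + γ) (hc' y) (hq' y) (isPartialInj_cons_of_free hT hx hy) ?_ ?_ ?_
      · rw [List.length_cons]; omega
      · linarith
      · linarith
    · simp only [mem_freeInputs, not_forall, not_not] at hx
      obtain ⟨p, hp, rfl⟩ := hx
      rw [discrepancy_classicalFwd_of_mem hT hp]
      refine (ih p.2 c q T ψ D (hc' _) (hq' _) hT (by omega) hβD (by linarith)).trans ?_
      exact hybridBound_mono (hD.le.trans hDA') hμ hβ.le hν c.le_succ le_rfl T ψ
  | classicalInv y next ih =>
    intro c q T ψ D hc hq hT hcN hβD hDA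
    obtain ⟨hD, hDA'⟩ := hA hβD hDA
    obtain ⟨c, rfl⟩ : ∃ c', c = c' + 1 :=
      ⟨c - 1, by simp only [QAlgorithm.classicalQueries] at hc; omega⟩
    have hc' : ∀ z, (next z).classicalQueries ≤ c := fun z =>
      (Finset.le_sup (f := fun z => (next z).classicalQueries) (mem_univ z)).trans
        (Nat.le_of_succ_le_succ hc)
    have hq' : ∀ z, (next z).quantumQueries ≤ q := fun z =>
      (Finset.le_sup (f := fun z => (next z).quantumQueries) (mem_univ z)).trans hq
    push_cast at hDA
    by_cases hy : y ∈ freeOutputs T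
    · rw [discrepancy_classicalInv_of_free hT hy]
      refine (Finset.abs_expect_le _ _).trans ?_
      refine le_trans (Finset.expect_le_expect fun x hx => ?_)
        (expect_hybridBound_cons_le (hD.le.trans hDA') hμ hγ hM hD c q
          ⟨_, inv_apply_mem_freeInputs hT 1 hy⟩ (T' := fun x => (x, y) :: T)
          (fun κ hκ => expect_deviation_cons_inv_le hT hy ψ hM (hlen hcN) hκ)
          (expect_expect_reprogramCipher_cons_inv hT hy fun (_ : FXKey m n) E' => ‖ψ E'‖ ^ 2))
      refine ih x c q _ ψ (D + γ) (hc' x) (hq' x) (isPartialInj_cons_of_free hT hx hy) ?_ ?_ ?_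
      · rw [List.length_cons]; omega
      · linarith
      · linarith
    · simp only [mem_freeOutputs, not_forall, not_not] at hy
      obtain ⟨p, hp, rfl⟩ := hy
      rw [discrepancy_classicalInv_of_mem hT hp]
      refine (ih p.1 c q T ψ D (hc' _) (hq' _) hT (by omega) hβD (by linarith)).trans ?_
      exact hybridBound_mono (hD.le.trans hDA') hμ hβ.le hν c.le_succ le_rfl T ψ
  | quantumFwd next ih =>
    intro c q T ψ D hc hq hT hcN hβD hDA
    obtain ⟨hD, hDA'⟩ := hA hβD hDA
    obtain ⟨q, rfl⟩ : ∃ q', q = q' + 1 :=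
      ⟨q - 1, by simp only [QAlgorithm.quantumQueries] at hq; omega⟩
    push_cast at hDA
    rw [discrepancy_quantumFwd]
    refine (ih c q T _ (D + β) hc (Nat.le_of_succ_le_succ hq) hT hcN (by linarith)
      (by linarith)).trans ?_
    exact hybridBound_query_le (hD.le.trans hDA') hμ hβ hν hβD (hβT hcN) c q
      (fun κ hκ => deviation_queryFwd_le hT ψ hκ) (weight_queryFwd ψ) (realWeight_queryFwd T ψ)
      (spread_queryFwd_le ψ)
  | quantumInv next ih =>
    intro c q T ψ D hc hq hT hcN hβD hDA
    obtain ⟨hD, hDA'⟩ := hA hβD hDA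
    obtain ⟨q, rfl⟩ : ∃ q', q = q' + 1 :=
      ⟨q - 1, by simp only [QAlgorithm.quantumQueries] at hq; omega⟩
    push_cast at hDA
    rw [discrepancy_quantumInv]
    refine (ih c q T _ (D + β) hc (Nat.le_of_succ_le_succ hq) hT hcN (by linarith)
      (by linarith)).trans ?_
    exact hybridBound_query_le (hD.le.trans hDA') hμ hβ hν hβD (hβT hcN) c q
      (fun κ hκ => deviation_queryInv_le hT ψ hκ) (weight_queryInv ψ) (realWeight_queryInv T ψ)
      (spread_queryInv_le ψ)

end Hybrid

/-! ### The advantage -/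

section Advantage

open Finset Equiv
open scoped BigOperators

variable {m n : ℕ} {W : Type*} [Fintype W]

lemma QAdversary.realProb_eq (A : QAdversary m n W) :
    A.realProb = realNow A.alg [] fun _ => A.init := by
  simp only [QAdversary.realProb, realNow, reprogramCipher_nil]
  rw [← Finset.univ_product_univ, Finset.expect_product]

lemma QAdversary.idealProb_eq (A : QAdversary m n W) :
    A.idealProb = idealNow A.alg [] fun _ => A.init := by
  simp only [QAdversary.idealProb, idealNow, reprogram_nil]
  rw [← Finset.univ_product_univ, Finset.expect_product]

/-- The bound on the advantage with free parameters: at the start of the run the states of the two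
runs agree and do not depend on the block cipher. -/
lemma QAdversary.abs_realProb_sub_idealProb_le (A : QAdversary m n W) {c q : ℕ}
    (hc : A.alg.classicalQueries ≤ c) (hq : A.alg.quantumQueries ≤ q) {μ β γ M D : ℝ}
    (hμ : 0 < μ) (hβ : 0 < β) (hγ : 0 < γ) (hM : 0 < M) (hMc : M + c ≤ 2 ^ n + 1)
    (hβc : 4 * (c : ℝ) / 2 ^ (m + n) ≤ β ^ 2) (hD : 2 * β ≤ D) :
    |A.realProb - A.idealProb| ≤ (D + c * γ + q * β) / (4 * μ) *
      (q * β + c * (2 ^ n / (M * γ)) * (q * (4 / 2 ^ (m + n)))) + μ := by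
  have h := abs_discrepancy_le hμ hβ hγ hM hMc hβc A.alg c q [] (fun _ => A.init) D hc hq
    isPartialInj_nil (by simp) hD le_rfl
  have hw : weight (fun _ : BlockCipher m n => A.init) = 1 := by simp [weight, A.norm_init]
  have hr : realWeight [] (fun _ : BlockCipher m n => A.init) = 1 := by
    simp [realWeight, A.norm_init]
  have hd : deviation [] (fun _ : BlockCipher m n => A.init) = 0 := by simp [deviation]
  have hs : spread (fun _ : BlockCipher m n => A.init) = 0 := by simp [spread]
  rw [discrepancy, ← A.realProb_eq, ← A.idealProb_eq, hybridBound, hw, hr, hd, hs, sub_self,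
    sub_zero, abs_mul, abs_two] at h
  have e : (D + c * γ + q * β) / (4 * μ) *
      (q * β + c * (2 ^ n / (M * γ)) * (q * (4 / 2 ^ (m + n)))) + μ =
      ((D + c * γ + q * β) / (2 * μ) * (0 / D + q * β * 1 +
        c * (2 ^ n / (M * γ)) * (0 + q * (4 / 2 ^ (m + n)) * 1)) + μ * (1 + 1)) / 2 := by
    ring
  rw [e]
  linarith

/-- Without quantum queries the parameter `μ` of the bound can be taken arbitrarily small. -/
lemma QAdversary.realProb_eq_idealProb_of_quantumQueries (A : QAdversary m n W) {c : ℕ}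
    (hc : A.alg.classicalQueries ≤ c) (hcn : c ≤ 2 ^ n) (hq : A.alg.quantumQueries ≤ 0) :
    A.realProb = A.idealProb := by
  have hcn' : (c : ℝ) ≤ 2 ^ n := by exact_mod_cast hcn
  refine eq_of_abs_sub_le_all fun μ hμ => ?_
  have hβ : 4 * (c : ℝ) / 2 ^ (m + n) ≤ (2 * (c + 1)) ^ 2 := by
    have h1 : (1 : ℝ) ≤ 2 ^ (m + n) := one_le_pow₀ one_le_two
    have h2 : (0 : ℝ) ≤ c := Nat.cast_nonneg c
    calc 4 * (c : ℝ) / 2 ^ (m + n) ≤ 4 * c := div_le_self (by positivity) h1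
      _ ≤ _ := by nlinarith
  have h := A.abs_realProb_sub_idealProb_le hc hq (M := 2 ^ n - c + 1) (D := 2 * (2 * (c + 1)))
    hμ (by positivity) one_pos (by linarith) (by linarith) hβ le_rfl
  simpa using h

/-- Without classical queries the parameters `μ` and `β` of the bound can be taken arbitrarily
small. -/
lemma QAdversary.realProb_eq_idealProb_of_classicalQueries (A : QAdversary m n W) {q : ℕ}
    (hc : A.alg.classicalQueries ≤ 0) (hq : A.alg.quantumQueries ≤ q) :
    A.realProb = A.idealProb := by
  refine eq_of_abs_sub_le_all fun ε hε => ?_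
  have hβ : 0 < ε / 2 / (q + 2) := by positivity
  have h := A.abs_realProb_sub_idealProb_le hc hq (M := 1) (γ := 1) (half_pos hε) hβ one_pos
    one_pos (by simp) (by simpa using sq_nonneg _) le_rfl
  refine h.trans ?_
  have e : (2 * (ε / 2 / (q + 2)) + ((0 : ℕ) : ℝ) * 1 + q * (ε / 2 / (q + 2))) / (4 * (ε / 2)) *
      (q * (ε / 2 / (q + 2)) + ((0 : ℕ) : ℝ) * (2 ^ n / (1 * 1)) * (q * (4 / 2 ^ (m + n)))) +
      ε / 2 = ε / 8 * (q / (q + 2)) + ε / 2 := by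
    have : (q : ℝ) + 2 ≠ 0 := by positivity
    push_cast
    field_simp
    ring
  rw [e]
  have h1 : (q : ℝ) / (q + 2) ≤ 1 := by
    rw [div_le_one (by positivity)]
    linarith
  nlinarith

end Advantage

theorem theorem1 (m n qC qQ : ℕ) (hm : 0 < m) (hn : 0 < n) (hqC : qC ≤ 2 ^ n)
    (W : Type*) [Fintype W] (A : QAdversary m n W)
    (hC : A.alg.classicalQueries ≤ qC) (hQ : A.alg.quantumQueries ≤ qQ) :
    |A.realProb - A.idealProb| ≤
      4 / Real.sqrt ((2 : ℝ) ^ m * ((2 : ℝ) ^ n - (qC : ℝ) + 1)) * ((qC : ℝ) * Real.sqrt (qQ : ℝ))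
        + 2 / Real.sqrt ((2 : ℝ) ^ (m + n)) * ((qQ : ℝ) * Real.sqrt (qC : ℝ)) := by
  rcases Nat.eq_zero_or_pos qC with rfl | hqC0
  · rw [A.realProb_eq_idealProb_of_classicalQueries hC hQ]
    simp
  rcases Nat.eq_zero_or_pos qQ with rfl | hqQ0
  · rw [A.realProb_eq_idealProb_of_quantumQueries hC hqC hQ]
    simp
  have hC1 : (1 : ℝ) ≤ qC := by exact_mod_cast hqC0
  have hQ1 : (1 : ℝ) ≤ qQ := by exact_mod_cast hqQ0
  have hCn : (qC : ℝ) ≤ 2 ^ n := by exact_mod_cast hqC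
  set M : ℝ := (2 : ℝ) ^ n - qC + 1 with hM
  have hM0 : 0 < M := by linarith
  set s := Real.sqrt qC with hs
  set t := Real.sqrt qQ with ht
  set X := Real.sqrt (2 ^ m * M) with hX
  set Y := Real.sqrt (2 ^ (m + n)) with hY
  have hs2 : (qC : ℝ) = s ^ 2 := (Real.sq_sqrt (by positivity)).symm
  have ht2 : (qQ : ℝ) = t ^ 2 := (Real.sq_sqrt (by positivity)).symm
  have hX2 : X ^ 2 = 2 ^ m * M := Real.sq_sqrt (by positivity)
  have hY2 : Y ^ 2 = 2 ^ (m + n) := Real.sq_sqrt (by positivity)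
  have hs1 : 1 ≤ s := Real.one_le_sqrt.2 hC1
  have ht1 : 1 ≤ t := Real.one_le_sqrt.2 hQ1
  have hX0 : 0 < X := Real.sqrt_pos.2 (by positivity)
  have hY0 : 0 < Y := Real.sqrt_pos.2 (by positivity)
  have hXY : X ≤ Y := by
    refine Real.sqrt_le_sqrt ?_
    rw [pow_add]
    gcongr
    linarith
  -- the total growth by `qC` classical and by `qQ` quantum queries, with the growth `2 * t / X` and
  -- `2 * s / Y` of a single one
  set g := 2 * s ^ 2 * t / X with hg
  set h := 2 * t ^ 2 * s / Y with hh
  have hg0 : 0 < g := by positivity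
  have hh0 : 0 < h := by positivity
  have hβg : 2 * s / Y ≤ g := by
    rw [hg, div_le_div_iff₀ hY0 hX0]
    calc 2 * s * X ≤ 2 * s * Y := by gcongr
      _ = 2 * s * (1 * 1) * Y := by ring
      _ ≤ 2 * s * (s * t) * Y := by gcongr
      _ = _ := by ring
  have key := A.abs_realProb_sub_idealProb_le hC hQ (μ := (2 * g + h) / 2) (β := 2 * s / Y)
    (γ := 2 * t / X) (M := M) (D := 2 * g) (by positivity) (by positivity) (by positivity) hM0
    (by linarith) (le_of_eq (by rw [← hY2, hs2]; ring)) (by linarith)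
  have e1 : (qC : ℝ) * (2 * t / X) = g := by rw [hg, hs2]; ring
  have e2 : (qQ : ℝ) * (2 * s / Y) = h := by rw [hh, ht2]; ring
  have e3 : (qC : ℝ) * (2 ^ n / (M * (2 * t / X))) * (qQ * (4 / 2 ^ (m + n))) = g := by
    have e4 : M = X ^ 2 / 2 ^ m := by rw [hX2]; field_simp
    rw [hg, hs2, ht2, e4, pow_add]
    field_simp
    ring
  rw [e1, e2, e3] at key
  have e5 : 4 / X * (qC * t) + 2 / Y * (qQ * s) = 2 * g + h := by
    rw [hg, hh, hs2, ht2]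
    ring
  rw [e5]
  refine key.trans ?_
  have e6 : (2 * g + g + h) / (4 * ((2 * g + h) / 2)) * (h + g) ≤ (2 * g + h) / 2 := by
    -- this is `(3 * g + h) * (g + h) ≤ (2 * g + h) ^ 2`
    rw [div_mul_eq_mul_div, div_le_iff₀ (by positivity)]
    nlinarith [mul_pos hg0 hg0]
  linarith
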